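/- An affine poset of order $n\ge 1$ is a partial order $\tilde P=(\mathbb Z,\preceq)$ such that, for all $i,j\in\mathbb Z$: $i\preceq i+n$; $i\preceq j\iff i+n\preceq j+n$; and $i\preceq j+kn$ for some $k\in\mathbb Z$. Write $\lessdot$ for its covering relation. A tube of $\tilde P$ is a subset $\tau\subseteq\mathbb Z$ with $|\tau|\ge 2$ that is convex for $\preceq$, connected as an induced subgraph of the Hasse diagram, and either equal to $\mathbb Z$ or containing at most one element of each residue class modulo $n$; it is proper if $\tau\ne\mathbb Z$. For disjoint tubes write $\sigma\prec\tau$ if $a\prec b$ for some $a\in\sigma$, $b\in\tau$. A proper tubing is a set $T$ of proper tubes, any two of which are nested or disjoint, such that $\tau+kn\in T$ for all $\tau\in T$, $k\in\mathbb Z$, and such that there is no cycle $\tau_1\prec\tau_2\prec\dots\prec\tau_k\prec\tau_1$ in $T$. It is maximal if it is maximal under inclusion among proper tubings. Let $A$ be the space of sequences $\tilde x=(\tilde x_i)_{i\in\mathbb Z}$ of real numbers with $\tilde x_{i+n}=\tilde x_i+n^{2(n+1)}$ for all $i$, taken modulo addition of constant sequences. For a finite $\tau\subset\mathbb Z$ put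 $$\alpha_\tau(\tilde x)=\sum_{i\lessdot j,\ i,j\in\tau}(\tilde x_j-\tilde x_i),\qquad h_\tau=\{\tilde x\in A:\alpha_\tau(\tilde x)\ge n^{2|\tau|}\}.$$ **Theorem.** For every affine poset $\tilde P$ of order $n$, the intersection (inside $A$) of the half-spaces $h_\tau$ over all proper tubes $\tau$ is a realization of the affine poset cyclohedron $\mathscr C(\tilde P)$. That is, it is a (nonempty) simple convex polytope of dimension $n-1$, and there is an isomorphism from the poset of its nonempty faces, ordered by inclusion, onto the set of proper tubings of $\tilde P$, ordered by reverse inclusion, under which the vertices correspond to the maximal proper tubings. -/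

import Mathlib

/-- An affine poset of order `n ≥ 1`: a partial order on `ℤ` (unrelated to the usual order of `ℤ`)
that is `n`-periodic, strongly connected, and satisfies `i ≼ i + n`. -/
structure AffinePoset (n : ℕ) where
  order : PartialOrder ℤ
  pos : 1 ≤ n
  le_add : ∀ i : ℤ, order.le i (i + n)
  periodic : ∀ i j : ℤ, order.le i j ↔ order.le (i + n) (j + n)
  stronglyConnected : ∀ i j : ℤ, ∃ k : ℤ, order.le i (j + k * n)

/-- The subspace of constant bi-infinite real sequences. -/
def constMaps : Submodule ℝ (ℤ → ℝ) where
  carrier := {x | ∃ a : ℝ, ∀ i, x i = a}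
  add_mem' := by
    rintro x y ⟨a, ha⟩ ⟨b, hb⟩
    exact ⟨a + b, fun i => by simp [ha, hb]⟩
  zero_mem' := ⟨0, fun _ => rfl⟩
  smul_mem' := by
    rintro r x ⟨a, ha⟩
    exact ⟨r * a, fun i => by simp [ha]⟩

/-- Bi-infinite real sequences modulo constant sequences, a real topological vector space. -/
abbrev SeqModConst : Type := (ℤ → ℝ) ⧸ constMaps

/-- Affine maps: sequences with `x (i + n) = x i + c` for all `i`. -/
def affineMaps (n : ℕ) (c : ℝ) : Set (ℤ → ℝ) :=
  {x | ∀ i : ℤ, x (i + n) = x i + c}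

/-- The ambient space: affine maps with constant `c = n ^ (2 (n + 1))`, modulo constant maps,
as an affine subspace of the space of all sequences modulo constants. -/
def ambientSpace (n : ℕ) : Set SeqModConst :=
  constMaps.mkQ '' affineMaps n ((n : ℝ) ^ (2 * (n + 1)))

namespace AffinePoset

variable {n : ℕ} (P : AffinePoset n)

/-- The covering relation `i ⋖ j` of the affine poset. -/
def Covers (i j : ℤ) : Prop := @CovBy ℤ P.order.toLT i j

/-- The Hasse diagram of the affine poset. -/
def hasseDiagram : SimpleGraph ℤ := @SimpleGraph.hasse ℤ P.order.toPreorder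

/-- Tubes: connected convex subsets with at least two elements that are either everything or
contain at most one element of each residue class modulo `n`. -/
structure IsTube (τ : Set ℤ) : Prop where
  connected : (P.hasseDiagram.induce τ).Connected
  convex : ∀ a ∈ τ, ∀ c ∈ τ, ∀ b : ℤ, P.order.le a b → P.order.le b c → b ∈ τ
  two_le : 2 ≤ τ.encard
  residues : τ = Set.univ ∨ ∀ i ∈ τ, ∀ j ∈ τ, i ≡ j [ZMOD n] → i = j

/-- A tube different from the whole poset is finite, so that finite sets suffice to
describe proper tubes. -/
theorem IsTube.finite {P : AffinePoset n} {τ : Set ℤ} (h : P.IsTube τ) (hτ : τ ≠ Set.univ) :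
    τ.Finite := by
  have hn : (0 : ℤ) < n := by exact_mod_cast P.pos
  have hres := h.residues.resolve_left hτ
  refine Set.Finite.of_finite_image (f := fun i : ℤ => i % n) ?_ ?_
  · refine (Set.finite_Ico (0 : ℤ) n).subset ?_
    rintro _ ⟨i, -, rfl⟩
    exact ⟨Int.emod_nonneg _ hn.ne', Int.emod_lt_of_pos _ hn⟩
  · intro i hi j hj hij
    exact hres i hi j hj hij

/-- Proper tubes: tubes different from the whole poset. -/
def IsProperTube (τ : Finset ℤ) : Prop := P.IsTube (τ : Set ℤ) ∧ (τ : Set ℤ) ≠ Set.univ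

/-- `σ ≺ τ` for disjoint tubes: some element of `σ` is strictly below some element of `τ`. -/
def Precedes (σ τ : Finset ℤ) : Prop :=
  Disjoint σ τ ∧ ∃ a ∈ σ, ∃ b ∈ τ, P.order.lt a b

/-- Proper tubings: `n`-periodic sets of proper tubes, pairwise nested or disjoint, such that
`≺` has no directed cycle `τ₁ ≺ ⋯ ≺ τₖ ≺ τ₁` inside the set. -/
structure IsProperTubing (T : Set (Finset ℤ)) : Prop where
  proper : ∀ τ ∈ T, P.IsProperTube τ
  periodic : ∀ τ ∈ T, ∀ k : ℤ, τ.image (fun i => i + k * n) ∈ T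
  nested_or_disjoint : ∀ σ ∈ T, ∀ τ ∈ T, σ ⊆ τ ∨ τ ⊆ σ ∨ Disjoint σ τ
  acyclic : ∀ τ ∈ T,
    ¬ Relation.TransGen (fun σ ρ => σ ∈ T ∧ ρ ∈ T ∧ P.Precedes σ ρ) τ τ

/-- The set of proper tubings, ordered by inclusion. -/
abbrev ProperTubing : Type := {T : Set (Finset ℤ) // P.IsProperTubing T}

open Classical in
/-- `α_τ` on sequences: the sum of `x j - x i` over the covering relations `i ⋖ j` inside `τ`. -/
noncomputable def alphaSeq (τ : Finset ℤ) : (ℤ → ℝ) →ₗ[ℝ] ℝ :=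
  ∑ e ∈ (τ ×ˢ τ).filter (fun e => P.Covers e.1 e.2),
    ((LinearMap.proj e.2 : (ℤ → ℝ) →ₗ[ℝ] ℝ) - LinearMap.proj e.1)

theorem constMaps_le_ker_alphaSeq (τ : Finset ℤ) :
    constMaps ≤ LinearMap.ker (P.alphaSeq τ) := by
  rintro x ⟨a, ha⟩
  simp [alphaSeq, ha]

/-- `α_τ` on sequences modulo constants. -/
noncomputable def alpha (τ : Finset ℤ) : SeqModConst →ₗ[ℝ] ℝ :=
  constMaps.liftQ (P.alphaSeq τ) (P.constMaps_le_ker_alphaSeq τ)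

/-- The half-space `h_τ` of the ambient space. -/
def halfSpace (τ : Finset ℤ) : Set SeqModConst :=
  {p ∈ ambientSpace n | (n : ℝ) ^ (2 * τ.card) ≤ P.alpha τ p}

/-- The intersection, inside the ambient space, of the half-spaces of all proper tubes. -/
def halfSpaceIntersection : Set SeqModConst :=
  {p ∈ ambientSpace n | ∀ τ : Finset ℤ, P.IsProperTube τ → p ∈ P.halfSpace τ}

end AffinePoset

section Polytopes

variable {E : Type*} [AddCommGroup E] [Module ℝ E] [TopologicalSpace E]

/-- Convex polytopes: convex hulls of nonempty finite sets. -/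
def IsConvexPolytope (Q : Set E) : Prop :=
  ∃ s : Finset E, s.Nonempty ∧ Q = convexHull ℝ (s : Set E)

/-- The dimension of a nonempty convex set is the dimension of its affine span. -/
noncomputable def polytopeDim (Q : Set E) : ℕ := Module.finrank ℝ (vectorSpan ℝ Q)

/-- The nonempty faces of `Q` (maximizing sets of linear functionals), ordered by inclusion. -/
abbrev NonemptyFace (Q : Set E) : Type _ := {F : Set E // IsExposed ℝ Q F ∧ F.Nonempty}

/-- A polytope of dimension `d` is simple if every vertex lies in exactly `d` facets. -/
def IsSimplePolytope (Q : Set E) : Prop :=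
  ∀ v : E, IsExposed ℝ Q {v} →
    {F : NonemptyFace Q | polytopeDim F.1 + 1 = polytopeDim Q ∧ v ∈ F.1}.encard = polytopeDim Q

end Polytopes

namespace AffinePoset

/-- `Q` is a realization of the affine poset cyclohedron of `P`: it is a simple convex polytope of
dimension `n - 1`, and its nonempty faces are in order-preserving bijection with the
proper tubings ordered by reverse inclusion, vertices corresponding to maximal tubings. -/
structure IsCyclohedronRealization {n : ℕ} (P : AffinePoset n) (Q : Set SeqModConst) : Prop where
  polytope : IsConvexPolytope Q
  dim : polytopeDim Q + 1 = n
  simple : IsSimplePolytope Q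
  faces : ∃ e : NonemptyFace Q ≃o (P.ProperTubing)ᵒᵈ,
    ∀ F : NonemptyFace Q,
      (∃ v, F.1 = {v}) ↔ Maximal P.IsProperTubing (OrderDual.ofDual (e F)).1

end AffinePoset

/-! The polyhedral part is formal. Take finitely many half-spaces and a down-closed family of index
sets containing `∅`. Suppose every feasible point has its tight set in the family, every member is
tight at some feasible point, the functionals of each member are independent, and the recession cone
is trivial. Then the polyhedron is a simple polytope whose face lattice is the family reversed
(`IsSimpleFor` and its consequences). Since `α_τ` takes the same value on all translates of `τ`, the
half-spaces are indexed by the finitely many translation orbits of proper tubes, and the family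
consists of the proper tubings. Four facts about affine posets remain.

Tight tubes form a tubing (`tight_separated`). Let `σ`, `τ` be tight, not nested, with an element of
`σ` below one of `τ`. If their values overlapped, the convex hull `ρ` of `σ ∪ τ` would have
oscillation at most `2 n ^ (2m)`, where `m < |ρ|` is the larger cardinality. If `ρ` is a tube, it
has fewer than `n² / 2` edges, so `α_ρ < n ^ (2|ρ|)`; otherwise `ρ` contains two congruent elements,
whose values differ by at least `n ^ (2(n+1))`. Both are impossible. So all values on `σ` are below
all values on `τ`, which excludes crossings and cycles.

Every tubing is attained (`exists_feasible`). Contracting its tubes gives a periodic preorder, and a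
height function on it cuts `ℤ` into translates of one convex block that split no tube of the tubing.
The block is solved recursively (`exists_isAdapted`): cut a convex set into a lower and an upper
part compatible with the tubing (`exists_split`), solve both, and raise the upper part until `α` of
the whole has the prescribed value. The factor `n²` per element makes every crossing edge long
enough for all smaller tubes across the cut.

Independence (`exists_periodic`): the periodic indicator of the upper part of a tube is nonzero on
that tube and vanishes on the other orbits of tubes that are not larger, so the system is triangular
by cardinality.

The recession cone is trivial (`eq_zero_of_alphaSeq_nonneg`): its elements are monotone and
periodic, hence constant by strong connectedness. -/

/-! ### Half-space systems and simple polytopes -/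

/-- Finitely many half-spaces `b i ≤ a i p` inside the affine subspace `base + dir`. -/
structure HalfSpaceSystem (E ι : Type*) [AddCommGroup E] [Module ℝ E] [TopologicalSpace E] where
  dir : Submodule ℝ E
  base : E
  a : ι → E →L[ℝ] ℝ
  b : ι → ℝ

namespace HalfSpaceSystem

variable {E ι : Type*} [AddCommGroup E] [Module ℝ E] [TopologicalSpace E]
  (H : HalfSpaceSystem E ι)

/-- The polyhedron cut out by the half-spaces. -/
def poly : Set E := {p | p - H.base ∈ H.dir ∧ ∀ i, H.b i ≤ H.a i p}

/-- The indices of the half-spaces having `p` on their boundary. -/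
def tight (p : E) : Set ι := {i | H.a i p = H.b i}

/-- The points of the polyhedron where all constraints indexed by `T` are tight. -/
def face (T : Set ι) : Set E := {p | p ∈ H.poly ∧ T ⊆ H.tight p}

/-- The directions along which the functionals indexed by `T` do not change. -/
def faceDir (T : Set ι) : Submodule ℝ E where
  carrier := {w | w ∈ H.dir ∧ ∀ i ∈ T, H.a i w = 0}
  add_mem' := fun {x y} hx hy =>
    ⟨H.dir.add_mem hx.1 hy.1, fun i hi => by simp [hx.2 i hi, hy.2 i hi]⟩
  zero_mem' := ⟨H.dir.zero_mem, fun i _ => by simp⟩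
  smul_mem' := fun r x hx => ⟨H.dir.smul_mem r hx.1, fun i hi => by simp [hx.2 i hi]⟩

/-- `TT` is the collection of index sets of the faces of a simple polytope: every tight set
belongs to it, every member of it is realized by a point, the functionals of each member are
independent, and the recession cone is trivial. -/
structure IsSimpleFor (TT : Set (Set ι)) : Prop where
  tight_mem : ∀ p ∈ H.poly, H.tight p ∈ TT
  exists_point : ∀ T ∈ TT, ∃ p ∈ H.poly, T ⊆ H.tight p
  independent : ∀ T ∈ TT, ∀ c : ι → ℝ, ∃ w ∈ H.dir, ∀ i ∈ T, H.a i w = c i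
  empty_mem : ∅ ∈ TT
  down : ∀ T ∈ TT, ∀ S ⊆ T, S ∈ TT
  recession : ∀ w ∈ H.dir, (∀ i, 0 ≤ H.a i w) → w = 0

variable {H}

theorem add_smul_mem_poly_dir {p w : E} (hp : p ∈ H.poly) (hw : w ∈ H.dir) (t : ℝ) :
    p + t • w - H.base ∈ H.dir := by
  have : p + t • w - H.base = (p - H.base) + t • w := by abel
  rw [this]
  exact H.dir.add_mem hp.1 (H.dir.smul_mem t hw)

theorem convex_poly : Convex ℝ H.poly := by
  intro x hx y hy s t hs ht hst
  refine ⟨?_, fun i => ?_⟩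
  · have : s • x + t • y - H.base = s • (x - H.base) + t • (y - H.base) := by
      have hb : H.base = (s + t) • H.base := by rw [hst, one_smul]
      conv_lhs => rw [hb]
      rw [add_smul, smul_sub, smul_sub]
      abel
    rw [this]
    exact H.dir.add_mem (H.dir.smul_mem _ hx.1) (H.dir.smul_mem _ hy.1)
  · have h1 := mul_le_mul_of_nonneg_left (hx.2 i) hs
    have h2 := mul_le_mul_of_nonneg_left (hy.2 i) ht
    have h3 : H.b i = s * H.b i + t * H.b i := by rw [← add_mul, hst, one_mul]
    simp only [map_add, map_smul, smul_eq_mul]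
    linarith

theorem IsSimpleFor.face_nonempty {TT : Set (Set ι)} (h : H.IsSimpleFor TT)
    {T : Set ι} (hT : T ∈ TT) : (H.face T).Nonempty := by
  obtain ⟨p, hp, hTp⟩ := h.exists_point T hT
  exact ⟨p, hp, hTp⟩

variable [Finite ι]

theorem eventually_strict {p : E} (hp : p ∈ H.poly) (w : E) :
    ∀ᶠ t in nhds (0 : ℝ), ∀ i, i ∉ H.tight p → H.b i < H.a i (p + t • w) := by
  rw [Filter.eventually_all]
  intro i
  by_cases hi : i ∈ H.tight p
  · exact Filter.Eventually.of_forall fun t h => absurd hi h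
  · have hlt : H.b i < H.a i p := lt_of_le_of_ne (hp.2 i) (fun h => hi h.symm)
    have hc : Filter.Tendsto (fun t : ℝ => H.a i p + t * H.a i w) (nhds 0)
        (nhds (H.a i p + 0 * H.a i w)) :=
      Continuous.tendsto (by fun_prop) 0
    have := hc.eventually (lt_mem_nhds (a := H.b i) (by simpa using hlt))
    filter_upwards [this] with t ht _
    simpa using ht

theorem exists_pos_strict {p : E} (hp : p ∈ H.poly) (w : E) :
    ∃ t : ℝ, 0 < t ∧ ∀ i, i ∉ H.tight p → H.b i < H.a i (p + t • w) := by
  have h := (eventually_strict hp w).filter_mono (nhdsWithin_le_nhds (s := Set.Ioi 0))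
  obtain ⟨t, ht, ht0⟩ := (h.and self_mem_nhdsWithin).exists
  exact ⟨t, ht0, ht⟩

theorem exists_pos_mem_face {p w : E} (hp : p ∈ H.poly) (hw : w ∈ H.faceDir (H.tight p)) :
    ∃ t : ℝ, 0 < t ∧ p + t • w ∈ H.face (H.tight p) := by
  obtain ⟨t, ht, hs⟩ := exists_pos_strict hp w
  have ha : ∀ i ∈ H.tight p, H.a i (p + t • w) = H.b i := by
    intro i hi
    simp only [map_add, map_smul, hw.2 i hi, smul_zero, add_zero]
    exact hi
  refine ⟨t, ht, ⟨add_smul_mem_poly_dir hp hw.1 t, fun i => ?_⟩, ha⟩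
  by_cases hi : i ∈ H.tight p
  · exact (ha i hi).ge
  · exact (hs i hi).le

/-- The exposing functional is minus the sum of the `a i` over `T`: on the polyhedron it is at most
minus the sum of the `b i`, with equality exactly when every term is tight. -/
theorem isExposed_face (T : Set ι) :
    IsExposed ℝ H.poly (H.face T) := by
  classical
  cases nonempty_fintype ι
  rintro ⟨q, hq⟩
  refine ⟨-∑ i ∈ T.toFinset, H.a i, ?_⟩
  have hle : ∀ p ∈ H.poly, ∑ i ∈ T.toFinset, H.b i ≤ ∑ i ∈ T.toFinset, H.a i p :=
    fun p hp => Finset.sum_le_sum fun i _ => hp.2 i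
  have hqs : ∑ i ∈ T.toFinset, H.a i q = ∑ i ∈ T.toFinset, H.b i :=
    Finset.sum_congr rfl fun i hi => hq.2 (by simpa using hi)
  ext p
  simp only [neg_apply, sum_apply, neg_le_neg_iff,
    Set.mem_ofPred_eq]
  constructor
  · rintro ⟨hp, hpT⟩
    refine ⟨hp, fun y hy => ?_⟩
    rw [Finset.sum_congr rfl fun i hi => (hpT (by simpa using hi) : H.a i p = H.b i)]
    exact hle y hy
  · rintro ⟨hp, hmin⟩
    refine ⟨hp, fun i hi => ?_⟩
    have h1 : ∑ i ∈ T.toFinset, H.b i = ∑ i ∈ T.toFinset, H.a i p :=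
      le_antisymm (hle p hp) (hqs ▸ hmin q hq.1)
    exact ((Finset.sum_eq_sum_iff_of_le fun i _ => hp.2 i).mp h1 i (by simpa using hi)).symm

namespace IsSimpleFor

variable {TT : Set (Set ι)}

/-- Moving in a direction that preserves the tight constraints, one eventually meets a new one. -/
theorem exists_hit (h : H.IsSimpleFor TT) {p w : E} (hp : p ∈ H.poly)
    (hw : w ∈ H.faceDir (H.tight p)) (hw0 : w ≠ 0) :
    ∃ t : ℝ, 0 < t ∧ p + t • w ∈ H.poly ∧ H.tight p ⊂ H.tight (p + t • w) := by
  classical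
  cases nonempty_fintype ι
  have hex : ∃ i, H.a i w < 0 := by
    by_contra hcon
    push Not at hcon
    exact hw0 (h.recession w hw.1 hcon)
  let s : Finset ι := Finset.univ.filter fun i => H.a i w < 0
  have hs : s.Nonempty := by
    obtain ⟨i, hi⟩ := hex
    exact ⟨i, by simp [s, hi]⟩
  obtain ⟨j, hj, hmin⟩ := s.exists_min_image (fun i => (H.a i p - H.b i) / (-H.a i w)) hs
  have hjneg : H.a j w < 0 := by simpa [s] using hj
  have hjt : j ∉ H.tight p := fun hjt => hjneg.ne (hw.2 j hjt)
  have hjlt : H.b j < H.a j p := lt_of_le_of_ne (hp.2 j) (fun h => hjt h.symm)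
  -- The smallest time at which a decreasing constraint becomes tight; until then no constraint is
  -- violated.
  set t := (H.a j p - H.b j) / (-H.a j w) with ht
  have htpos : 0 < t := div_pos (by linarith) (by linarith)
  refine ⟨t, htpos, ⟨add_smul_mem_poly_dir hp hw.1 t, fun i => ?_⟩, ?_⟩
  · simp only [map_add, map_smul, smul_eq_mul]
    by_cases hi : H.a i w < 0
    · have hle := hmin i (by simp [s, hi])
      have hneg : 0 < -H.a i w := by linarith
      rw [le_div_iff₀ hneg] at hle
      linarith
    · have := mul_nonneg htpos.le (not_lt.mp hi)
      linarith [hp.2 i]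
  · refine (Set.ssubset_iff_of_subset fun i hi => ?_).2 ⟨j, ?_, hjt⟩
    · have : H.a i p = H.b i := hi
      simp [tight, hw.2 i hi, this]
    · have : t * H.a j w = -(H.a j p - H.b j) := by
        rw [ht, div_mul_eq_mul_div, div_eq_iff (by linarith)]; ring
      simp only [tight, Set.mem_ofPred_eq, map_add, map_smul, smul_eq_mul]
      linarith

/-- The points lying on no nontrivial segment of their face. -/
theorem finite_vertices : {p | p ∈ H.poly ∧ H.faceDir (H.tight p) = ⊥}.Finite := by
  -- Such a point is determined by its tight set, since the difference of two points with the same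
  -- tight set lies in the zero `faceDir`.
  refine Set.Finite.of_finite_image (f := H.tight) (Set.toFinite _) ?_
  rintro p ⟨hp, hp'⟩ q ⟨hq, -⟩ hpq
  have hmem : p - q ∈ H.faceDir (H.tight p) := by
    refine ⟨?_, fun i hi => ?_⟩
    · have : p - q = (p - H.base) - (q - H.base) := by abel
      rw [this]
      exact H.dir.sub_mem hp.1 hq.1
    · have h1 : H.a i p = H.b i := hi
      have h2 : i ∈ H.tight q := hpq ▸ hi
      have h2' : H.a i q = H.b i := h2
      rw [map_sub, h1, h2', sub_self]
  rw [hp', Submodule.mem_bot] at hmem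
  exact sub_eq_zero.mp hmem

/-- A point that is not a vertex lies between two points with strictly larger tight sets, reached
along `w` and `-w`; induction is on the number of constraints that are not tight. -/
theorem mem_convexHull (h : H.IsSimpleFor TT) {p : E} (hp : p ∈ H.poly) :
    p ∈ convexHull ℝ {p | p ∈ H.poly ∧ H.faceDir (H.tight p) = ⊥} := by
  induction hm : ((H.tight p)ᶜ).ncard using Nat.strong_induction_on generalizing p with
  | _ m ih =>
  by_cases hbot : H.faceDir (H.tight p) = ⊥
  · exact subset_convexHull ℝ _ ⟨hp, hbot⟩
  obtain ⟨w, hw, hw0⟩ := Submodule.exists_mem_ne_zero_of_ne_bot hbot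
  have key : ∀ w ∈ H.faceDir (H.tight p), w ≠ 0 → ∃ t : ℝ, 0 < t ∧
      p + t • w ∈ convexHull ℝ {p | p ∈ H.poly ∧ H.faceDir (H.tight p) = ⊥} := by
    intro w hw hw0
    obtain ⟨t, ht, hmem, hss⟩ := h.exists_hit hp hw hw0
    refine ⟨t, ht, ih _ ?_ hmem rfl⟩
    rw [← hm]
    exact Set.ncard_lt_ncard (compl_lt_compl_iff_lt.mpr hss) (Set.toFinite _)
  obtain ⟨t, ht, h1⟩ := key w hw hw0
  obtain ⟨s, hs, h2⟩ := key (-w) (Submodule.neg_mem _ hw) (neg_ne_zero.mpr hw0)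
  have hst : 0 < s + t := by linarith
  have := (convex_convexHull ℝ {p | p ∈ H.poly ∧ H.faceDir (H.tight p) = ⊥}) h1 h2
    (a := s / (s + t)) (b := t / (s + t)) (by positivity) (by positivity) (by field_simp)
  convert this using 1
  have e1 : s / (s + t) + t / (s + t) = 1 := by field_simp
  have e2 : s / (s + t) * t - t / (s + t) * s = 0 := by ring
  calc p = (s / (s + t) + t / (s + t)) • p + (s / (s + t) * t - t / (s + t) * s) • w := by
        rw [e1, e2, one_smul, zero_smul, add_zero]
    _ = _ := by
        rw [add_smul, sub_smul, smul_add, smul_add, smul_neg, smul_neg, smul_smul, smul_smul]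
        abel

theorem isConvexPolytope (h : H.IsSimpleFor TT) : IsConvexPolytope H.poly := by
  have hfin := finite_vertices (H := H)
  have heq : H.poly = convexHull ℝ {p | p ∈ H.poly ∧ H.faceDir (H.tight p) = ⊥} :=
    subset_antisymm (fun p hp => h.mem_convexHull hp)
      (convexHull_min (fun p hp => hp.1) convex_poly)
  refine ⟨hfin.toFinset, ?_, by simpa using heq⟩
  obtain ⟨p, hp, -⟩ := h.exists_point ∅ h.empty_mem
  rw [heq] at hp
  have := (convexHull_nonempty_iff (𝕜 := ℝ)).mp ⟨p, hp⟩
  simpa using this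

/-- Independence on the whole tight set of `p` gives a direction that fixes the functionals of `T`
and increases the superfluous tight ones; a small step along it loosens exactly those. The result is
a relative interior point of the face. -/
theorem exists_tight_eq (h : H.IsSimpleFor TT) {T : Set ι} (hT : T ∈ TT) :
    ∃ p ∈ H.poly, H.tight p = T := by
  classical
  obtain ⟨p, hp, hTp⟩ := h.exists_point T hT
  obtain ⟨w, hw, hc⟩ := h.independent _ (h.tight_mem p hp) fun i => if i ∈ T then 0 else 1
  obtain ⟨t, ht, hs⟩ := exists_pos_strict hp w
  have hval : ∀ i, H.a i (p + t • w) = H.a i p + t * H.a i w := fun i => by simp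
  have h1 : ∀ i ∈ T, H.a i (p + t • w) = H.b i := by
    intro i hi
    rw [hval, hc i (hTp hi), if_pos hi, mul_zero, add_zero]
    exact hTp hi
  have h2 : ∀ i ∉ T, H.b i < H.a i (p + t • w) := by
    intro i hi
    by_cases hip : i ∈ H.tight p
    · have hip' : H.a i p = H.b i := hip
      rw [hval, hc i hip, if_neg hi, hip']
      linarith
    · exact hs i hip
  refine ⟨p + t • w, ⟨add_smul_mem_poly_dir hp hw t, fun i => ?_⟩, ?_⟩
  · by_cases hi : i ∈ T
    · exact (h1 i hi).ge
    · exact (h2 i hi).le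
  · ext i
    change H.a i (p + t • w) = H.b i ↔ i ∈ T
    by_cases hi : i ∈ T
    · exact iff_of_true (h1 i hi) hi
    · exact iff_of_false (h2 i hi).ne' hi

theorem vectorSpan_face (h : H.IsSimpleFor TT) {T : Set ι} (hT : T ∈ TT) :
    vectorSpan ℝ (H.face T) = H.faceDir T := by
  apply le_antisymm
  · rw [vectorSpan_def, Submodule.span_le]
    rintro _ ⟨p, hp, q, hq, rfl⟩
    refine ⟨?_, fun i hi => ?_⟩
    · have : p - q = (p - H.base) - (q - H.base) := by abel
      change p - q ∈ H.dir
      rw [this]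
      exact H.dir.sub_mem hp.1.1 hq.1.1
    · have h1 : H.a i p = H.b i := hp.2 hi
      have h2 : H.a i q = H.b i := hq.2 hi
      change H.a i (p - q) = 0
      rw [map_sub, h1, h2, sub_self]
  · intro w hw
    obtain ⟨p, hp, rfl⟩ := h.exists_tight_eq hT
    obtain ⟨t, ht, hmem⟩ := exists_pos_mem_face hp hw
    have := vsub_mem_vectorSpan ℝ hmem (⟨hp, subset_rfl⟩ : p ∈ H.face (H.tight p))
    rw [vsub_eq_sub, add_sub_cancel_left] at this
    exact (Submodule.smul_mem_iff _ ht.ne').mp this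

/-- Rank-nullity for the evaluation map from `dir` to `ℝ ^ T`, which is onto by independence and has
kernel `faceDir T`. -/
theorem polytopeDim_face (h : H.IsSimpleFor TT) [FiniteDimensional ℝ H.dir] {T : Set ι}
    (hT : T ∈ TT) : polytopeDim (H.face T) + T.ncard = Module.finrank ℝ H.dir := by
  classical
  cases nonempty_fintype ι
  rw [polytopeDim, h.vectorSpan_face hT]
  let f : H.dir →ₗ[ℝ] (T → ℝ) := LinearMap.pi fun i => (H.a i.1).toLinearMap ∘ₗ H.dir.subtype
  have hsurj : Function.Surjective f := by
    intro c
    obtain ⟨w, hw, hc⟩ := h.independent T hT fun i => if hi : i ∈ T then c ⟨i, hi⟩ else 0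
    refine ⟨⟨w, hw⟩, ?_⟩
    ext i
    simp [f, hc i i.2]
  have hrank := f.finrank_range_add_finrank_ker
  rw [LinearMap.range_eq_top.mpr hsurj, finrank_top, Module.finrank_fintype_fun_eq_card] at hrank
  have hker : H.faceDir T = (LinearMap.ker f).map H.dir.subtype := by
    ext w
    constructor
    · intro hw
      refine ⟨⟨w, hw.1⟩, ?_, rfl⟩
      rw [SetLike.mem_coe, LinearMap.mem_ker]
      ext i
      simp [f, hw.2 i i.2]
    · rintro ⟨v, hv, rfl⟩
      refine ⟨v.2, fun i hi => ?_⟩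
      have := congrFun (LinearMap.mem_ker.mp hv) ⟨i, hi⟩
      simpa [f] using this
  rw [hker, Submodule.finrank_map_subtype_eq]
  rw [← Nat.card_coe_set_eq, Nat.card_eq_fintype_card]
  omega

theorem face_subset_face (h : H.IsSimpleFor TT) {S T : Set ι} (hT : T ∈ TT) :
    H.face T ⊆ H.face S ↔ S ⊆ T := by
  constructor
  · intro hsub
    obtain ⟨p, hp, rfl⟩ := h.exists_tight_eq hT
    exact (hsub ⟨hp, subset_rfl⟩).2
  · exact fun hST p hp => ⟨hp.1, hST.trans hp.2⟩

theorem exists_face_eq (h : H.IsSimpleFor TT) {F : Set E} (hF : IsExposed ℝ H.poly F)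
    (hne : F.Nonempty) : ∃ T ∈ TT, F = H.face T := by
  classical
  obtain ⟨l, hl⟩ := hF hne
  have hFp : ∀ p ∈ F, p ∈ H.poly := fun p hp => by rw [hl] at hp; exact hp.1
  -- A point of `F` with minimal tight set plays the role of a relative interior point. The midpoint
  -- of `p` and `q` is tight only where both are, so minimality forces the tight set of `p` into
  -- that of every `q ∈ F`.
  obtain ⟨p, hpF, hmin⟩ := exists_minimalFor_of_wellFoundedLT (· ∈ F) H.tight hne
  have hpm : ∀ y ∈ H.poly, l y ≤ l p := by
    have := hpF
    rw [hl] at this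
    exact this.2
  refine ⟨H.tight p, h.tight_mem p (hFp p hpF), subset_antisymm (fun q hqF => ?_) fun y hy => ?_⟩
  · refine ⟨hFp q hqF, ?_⟩
    have hq := hFp q hqF
    have hp := hFp p hpF
    have hlq : l q = l p := by
      rw [hl] at hqF
      exact le_antisymm (hpm q hq) (hqF.2 p hp)
    have hmem : (1 / 2 : ℝ) • p + (1 / 2 : ℝ) • q ∈ H.poly :=
      convex_poly hp hq (by norm_num) (by norm_num) (by norm_num)
    have hmF : (1 / 2 : ℝ) • p + (1 / 2 : ℝ) • q ∈ F := by
      rw [hl]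
      refine ⟨hmem, fun y hy => ?_⟩
      have := hpm y hy
      simp only [map_add, map_smul, smul_eq_mul, hlq]
      linarith
    have hval : ∀ i ∈ H.tight ((1 / 2 : ℝ) • p + (1 / 2 : ℝ) • q),
        i ∈ H.tight p ∧ i ∈ H.tight q := by
      intro i hi
      have hi' : H.a i ((1 / 2 : ℝ) • p + (1 / 2 : ℝ) • q) = H.b i := hi
      simp only [map_add, map_smul, smul_eq_mul] at hi'
      have h1 := hp.2 i
      have h2 := hq.2 i
      constructor
      · change H.a i p = H.b i
        linarith
      · change H.a i q = H.b i
        linarith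
    exact (hmin hmF fun i hi => (hval i hi).1).trans fun i hi => (hval i hi).2
  · have hw : p - y ∈ H.faceDir (H.tight p) := by
      rw [← h.vectorSpan_face (h.tight_mem p (hFp p hpF))]
      exact vsub_mem_vectorSpan ℝ ⟨hFp p hpF, subset_rfl⟩ hy
    -- The segment from `y` to `p` extends slightly beyond `p` inside the face; as `l` is maximal at
    -- `p`, it cannot be smaller at `y`.
    obtain ⟨t, ht, hmem⟩ := exists_pos_mem_face (hFp p hpF) hw
    have := hpm _ hmem.1
    simp only [map_add, map_smul, map_sub, smul_eq_mul] at this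
    have hle : l p ≤ l y := by
      by_contra hcon
      have := mul_pos ht (sub_pos.mpr (not_le.mp hcon))
      linarith
    rw [hl]
    exact ⟨hy.1, fun z hz => (hpm z hz).trans hle⟩

/-- The face lattice of the polytope is anti-isomorphic to the collection of index sets. -/
noncomputable def faceIso (h : H.IsSimpleFor TT) : {T // T ∈ TT}ᵒᵈ ≃o NonemptyFace H.poly :=
  RelIso.ofSurjective
    (OrderEmbedding.ofMapLEIff
      (fun T => ⟨H.face (OrderDual.ofDual T).1,
        isExposed_face _, h.face_nonempty (OrderDual.ofDual T).2⟩)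
      (fun S _ => h.face_subset_face (OrderDual.ofDual S).2))
    (by
      rintro ⟨F, hF, hne⟩
      obtain ⟨T, hT, rfl⟩ := h.exists_face_eq hF hne
      exact ⟨OrderDual.toDual ⟨T, hT⟩, rfl⟩)

/-- A face with a nonzero direction contains a point with a strictly larger tight set, again in
`TT`, so a maximal index set leaves no direction. -/
theorem face_eq_singleton_iff (h : H.IsSimpleFor TT) {T : Set ι} (hT : T ∈ TT) :
    (∃ v, H.face T = {v}) ↔ Maximal (· ∈ TT) T := by
  constructor
  · rintro ⟨v, hv⟩
    refine ⟨hT, fun S hS hTS => ?_⟩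
    have hsub := (h.face_subset_face hS).mpr hTS
    rw [← h.face_subset_face hT]
    rw [hv] at hsub ⊢
    rw [(Set.subset_singleton_iff_eq.mp hsub).resolve_left (h.face_nonempty hS).ne_empty]
  · intro hmax
    obtain ⟨p, hp, rfl⟩ := h.exists_tight_eq hT
    have hbot : H.faceDir (H.tight p) = ⊥ := by
      by_contra hbot
      obtain ⟨w, hw, hw0⟩ := Submodule.exists_mem_ne_zero_of_ne_bot hbot
      obtain ⟨t, -, hmem, hss⟩ := h.exists_hit hp hw hw0
      exact hss.2 (hmax.2 (h.tight_mem _ hmem) hss.1)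
    refine ⟨p, subset_antisymm (fun q hq => ?_) (by simpa using ⟨hp, subset_rfl⟩)⟩
    have : q - p ∈ H.faceDir (H.tight p) := by
      rw [← h.vectorSpan_face hT]
      exact vsub_mem_vectorSpan ℝ hq ⟨hp, subset_rfl⟩
    rw [hbot, Submodule.mem_bot] at this
    exact sub_eq_zero.mp this

theorem polytopeDim_poly (h : H.IsSimpleFor TT) [FiniteDimensional ℝ H.dir] :
    polytopeDim H.poly = Module.finrank ℝ H.dir := by
  have := h.polytopeDim_face h.empty_mem
  have hpoly : H.face ∅ = H.poly := by ext p; simp [face]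
  simpa [hpoly] using this

/-- A vertex is the face of some `T` whose cardinality is the dimension, and the facets through it
are the faces of the singletons of `T`. -/
theorem isSimplePolytope (h : H.IsSimpleFor TT) [FiniteDimensional ℝ H.dir] :
    IsSimplePolytope H.poly := by
  intro v hv
  obtain ⟨T, hT, hvT⟩ := h.exists_face_eq hv (Set.singleton_nonempty v)
  have hTdim := h.polytopeDim_face hT
  rw [← hvT, polytopeDim, vectorSpan_singleton, finrank_bot, zero_add] at hTdim
  have hsing : ∀ i ∈ T, {i} ∈ TT := fun i hi => h.down T hT _ (by simpa using hi)
  have himg : {F : NonemptyFace H.poly | polytopeDim F.1 + 1 = polytopeDim H.poly ∧ v ∈ F.1} =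
      (fun i : T => (⟨H.face {i.1}, isExposed_face _, h.face_nonempty (hsing i.1 i.2)⟩ :
        NonemptyFace H.poly)) '' Set.univ := by
    ext ⟨F, hF, hne⟩
    simp only [Set.mem_ofPred_eq, Set.image_univ, Set.mem_range, Subtype.mk.injEq]
    constructor
    · rintro ⟨hdim, hvF⟩
      obtain ⟨S, hS, rfl⟩ := h.exists_face_eq hF hne
      have h1 := h.polytopeDim_face hS
      rw [h.polytopeDim_poly] at hdim
      obtain ⟨i, rfl⟩ := Set.ncard_eq_one.mp (show S.ncard = 1 by omega)
      have hiT : {i} ⊆ T := by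
        rw [← h.face_subset_face hT, ← hvT]
        simpa using hvF
      exact ⟨⟨i, by simpa using hiT⟩, rfl⟩
    · rintro ⟨i, rfl⟩
      have h1 := h.polytopeDim_face (hsing i.1 i.2)
      rw [Set.ncard_singleton] at h1
      refine ⟨by rw [h1, h.polytopeDim_poly], ?_⟩
      have : H.face T ⊆ H.face {i.1} := (h.face_subset_face hT).mpr (by simp)
      rw [← hvT] at this
      simpa using this
  rw [himg, Function.Injective.encard_image, Set.encard_univ, h.polytopeDim_poly, ← hTdim]
  · rw [ENat.card_coe_set_eq, Set.Finite.cast_ncard_eq (Set.toFinite T)]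
  · intro i j hij
    have hij' : H.face {i.1} = H.face {j.1} := congrArg Subtype.val hij
    have := (h.face_subset_face (hsing i.1 i.2)).mp hij'.subset
    exact Subtype.ext (this rfl).symm

end IsSimpleFor
end HalfSpaceSystem

/-! ### Order structure of an affine poset -/

namespace AffinePoset

theorem cast_pos {n : ℕ} (P : AffinePoset n) : (0 : ℤ) < n := by exact_mod_cast P.pos

variable {n : ℕ} (P : AffinePoset n)

theorem lt_iff {a b : ℤ} : P.order.lt a b ↔ P.order.le a b ∧ a ≠ b :=
  @lt_iff_le_and_ne ℤ P.order a b

theorem le_add_mul_iff (k i j : ℤ) :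
    P.order.le (i + k * n) (j + k * n) ↔ P.order.le i j := by
  induction k using Int.induction_on with
  | zero => simp
  | succ k ih =>
    rw [← ih, P.periodic (i + k * n)]
    ring_nf
  | pred k ih =>
    rw [← ih, P.periodic (i + (-(k : ℤ) - 1) * n)]
    ring_nf

theorem lt_add_mul_iff (k i j : ℤ) :
    P.order.lt (i + k * n) (j + k * n) ↔ P.order.lt i j := by
  rw [P.lt_iff, P.lt_iff, P.le_add_mul_iff, Ne, add_left_inj]

theorem le_add_mul (i : ℤ) {k : ℤ} (hk : 0 ≤ k) : P.order.le i (i + k * n) := by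
  induction k, hk using Int.leInduction with
  | base => simpa using P.order.le_refl i
  | succ k _ ih =>
    refine P.order.le_trans _ _ _ ih ?_
    have := P.le_add (i + k * n)
    rwa [show i + k * n + n = i + (k + 1) * n by ring] at this

theorem covers_iff {i j : ℤ} : P.Covers i j ↔
    P.order.lt i j ∧ ∀ c, P.order.le i c → P.order.le c j → c = i ∨ c = j := by
  constructor
  · rintro ⟨h, h'⟩
    refine ⟨h, fun c h1 h2 => ?_⟩
    by_contra hcon
    rw [not_or] at hcon
    exact h' (P.lt_iff.mpr ⟨h1, Ne.symm hcon.1⟩) (P.lt_iff.mpr ⟨h2, hcon.2⟩)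
  · rintro ⟨h, h'⟩
    refine ⟨h, fun c h1 h2 => ?_⟩
    rw [P.lt_iff] at h1 h2
    rcases h' c h1.1 h2.1 with rfl | rfl
    · exact h1.2 rfl
    · exact h2.2 rfl

variable {P} in
theorem Covers.le {i j : ℤ} (h : P.Covers i j) : P.order.le i j :=
  (P.lt_iff.mp (P.covers_iff.mp h).1).1

variable {P} in
theorem Covers.ne {i j : ℤ} (h : P.Covers i j) : i ≠ j :=
  (P.lt_iff.mp (P.covers_iff.mp h).1).2

theorem covers_add_mul_iff (k i j : ℤ) : P.Covers (i + k * n) (j + k * n) ↔ P.Covers i j := by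
  rw [P.covers_iff, P.covers_iff, P.lt_add_mul_iff]
  refine and_congr_right fun _ => ⟨fun h c h1 h2 => ?_, fun h c h1 h2 => ?_⟩
  · have := h (c + k * n) ((P.le_add_mul_iff k _ _).mpr h1) ((P.le_add_mul_iff k _ _).mpr h2)
    simpa using this
  · have h1' := (P.le_add_mul_iff (-k) _ _).mpr h1
    have h2' := (P.le_add_mul_iff (-k) _ _).mpr h2
    rw [show i + k * n + -k * n = i by ring] at h1'
    rw [show j + k * n + -k * n = j by ring] at h2'
    rcases h _ h1' h2' with h3 | h3
    · left; linear_combination h3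
    · right; linear_combination h3

/-- Elements that are far enough apart as integers are comparable. -/
theorem exists_bound : ∃ K : ℤ, 1 ≤ K ∧ ∀ i j : ℤ, i / n + K ≤ j / n → P.order.le i j := by
  choose k hk using P.stronglyConnected
  let s : Finset (ℤ × ℤ) := Finset.Ico 0 (n : ℤ) ×ˢ Finset.Ico 0 (n : ℤ)
  refine ⟨1 + ∑ e ∈ s, |k e.1 e.2|, ?_, fun i j hij => ?_⟩
  · have : 0 ≤ ∑ e ∈ s, |k e.1 e.2| := Finset.sum_nonneg fun _ _ => abs_nonneg _
    linarith
  · have hn := P.cast_pos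
    have hmem : (i % n, j % n) ∈ s := by
      simp [s, Int.emod_nonneg _ hn.ne', Int.emod_lt_of_pos _ hn]
    have h1 : |k (i % n) (j % n)| ≤ ∑ e ∈ s, |k e.1 e.2| :=
      Finset.single_le_sum (f := fun e : ℤ × ℤ => |k e.1 e.2|) (fun _ _ => abs_nonneg _) hmem
    have h2 : k (i % n) (j % n) ≤ j / n - i / n := by
      have := le_abs_self (k (i % n) (j % n))
      linarith
    have h3 := hk (i % n) (j % n)
    have h4 := P.le_add_mul (j % n + k (i % n) (j % n) * n) (sub_nonneg.mpr h2)
    have h5 := P.order.le_trans _ _ _ h3 h4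
    have h6 := (P.le_add_mul_iff (i / n) _ _).mpr h5
    have ei := Int.emod_add_mul_ediv i n
    have ej := Int.emod_add_mul_ediv j n
    convert h6 using 1
    · linear_combination -ei
    · linear_combination -ej

/-- By `exists_bound`, an element cannot lie below another one that is too many periods earlier, so
order intervals are bounded in the usual order of `ℤ`. -/
theorem finite_interval (a b : ℤ) : {c | P.order.le a c ∧ P.order.le c b}.Finite := by
  obtain ⟨K, hK1, hK⟩ := P.exists_bound
  have hn := P.cast_pos
  refine (Set.finite_Icc ((a / n - K) * n) ((b / n + K + 1) * n)).subset ?_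
  rintro c ⟨h1, h2⟩
  have key : ∀ i j : ℤ, P.order.le i j → i / n < j / n + K := by
    intro i j hij
    by_contra hcon
    have := P.order.le_antisymm _ _ hij (hK j i (not_lt.mp hcon))
    subst this
    linarith
  have h3 := key a c h1
  have h4 := key c b h2
  have ec := Int.emod_add_mul_ediv c n
  have e1 := Int.emod_nonneg c hn.ne'
  have e2 := Int.emod_lt_of_pos c hn
  constructor
  · nlinarith
  · nlinarith

theorem exists_covers_bound : ∃ C : ℕ, ∀ i j : ℤ, P.Covers i j → (i - j).natAbs ≤ C := by
  obtain ⟨K, hK1, hK⟩ := P.exists_bound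
  have hn := P.cast_pos
  refine ⟨((K + 1) * n).toNat, fun i j hij => ?_⟩
  have h1 : i / n < j / n + K := by
    by_contra hcon
    exact hij.ne (P.order.le_antisymm _ _ hij.le (hK j i (not_lt.mp hcon)))
  have h2 : j / n ≤ i / n + K := by
    by_contra hcon
    have hdiv : (j - n) / n = j / n - 1 := by
      rw [Int.sub_ediv_of_dvd _ (dvd_refl _), Int.ediv_self hn.ne']
    -- If `j` were too far beyond `i`, then `j - n` would lie strictly between them in the partial
    -- order.
    have hle : P.order.le i (j - n) := hK _ _ (by omega)
    have hle' : P.order.le (j - n) j := by simpa using P.le_add (j - n)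
    rcases (P.covers_iff.mp hij).2 _ hle hle' with h | h
    · rw [h] at hdiv; omega
    · omega
  have ei := Int.emod_add_mul_ediv i n
  have ej := Int.emod_add_mul_ediv j n
  have i1 := Int.emod_nonneg i hn.ne'
  have i2 := Int.emod_lt_of_pos i hn
  have j1 := Int.emod_nonneg j hn.ne'
  have j2 := Int.emod_lt_of_pos j hn
  have h3 : i - j ≤ (K + 1) * n := by nlinarith
  have h4 : j - i ≤ (K + 1) * n := by nlinarith
  omega

theorem reflTransGen_covers {a b : ℤ} (h : P.order.le a b) :
    Relation.ReflTransGen P.Covers a b := by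
  let _ : @LocallyFiniteOrder ℤ P.order.toPreorder :=
    @LocallyFiniteOrder.ofFiniteIcc ℤ P.order.toPreorder P.finite_interval
  exact (@le_iff_reflTransGen_covBy ℤ P.order _ a b).mp h

/-- Sequences increasing along covering relations are monotone. -/
theorem monotone_of_covers {β : Type*} [Preorder β] {x : ℤ → β}
    (hx : ∀ i j, P.Covers i j → x i ≤ x j) {i j : ℤ} (h : P.order.le i j) : x i ≤ x j := by
  have hij := P.reflTransGen_covers h
  clear h
  induction hij with
  | refl => exact le_rfl
  | tail _ h1 ih => exact ih.trans (hx _ _ h1)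

/-- Convex subsets for the partial order. -/
def OrdConvex (S : Set ℤ) : Prop :=
  ∀ a ∈ S, ∀ c ∈ S, ∀ b : ℤ, P.order.le a b → P.order.le b c → b ∈ S

/-- A chain of covering relations from `a` to `b` stays inside `S` by convexity. -/
theorem reachable_of_le {S : Set ℤ} (hS : P.OrdConvex S) {a b : ℤ} (ha : a ∈ S) (hb : b ∈ S)
    (h : P.order.le a b) : (P.hasseDiagram.induce S).Reachable ⟨a, ha⟩ ⟨b, hb⟩ := by
  have key : ∀ c (hcb : Relation.ReflTransGen P.Covers c b), P.order.le c b ∧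
      ∀ hc : c ∈ S, (P.hasseDiagram.induce S).Reachable ⟨c, hc⟩ ⟨b, hb⟩ := by
    intro c hcb
    induction hcb using Relation.ReflTransGen.head_induction_on with
    | refl => exact ⟨P.order.le_refl b, fun _ => SimpleGraph.Reachable.rfl⟩
    | head h1 _ ih =>
      refine ⟨P.order.le_trans _ _ _ h1.le ih.1, fun hc => ?_⟩
      have hd := hS _ hc _ hb _ h1.le ih.1
      refine SimpleGraph.Reachable.trans (SimpleGraph.Adj.reachable ?_) (ih.2 hd)
      exact Or.inl h1
  exact (key a (P.reflTransGen_covers h)).2 ha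

/-- A connected set has a covering relation across any cut. -/
theorem exists_covers_of_cut {S : Set ℤ} (hS : (P.hasseDiagram.induce S).Connected)
    (p : ℤ → Prop) {u v : ℤ} (hu : u ∈ S) (hv : v ∈ S) (hpu : p u) (hpv : ¬ p v) :
    ∃ i ∈ S, ∃ j ∈ S, P.Covers i j ∧ (p i ∧ ¬ p j ∨ ¬ p i ∧ p j) := by
  obtain ⟨w⟩ := hS.preconnected ⟨u, hu⟩ ⟨v, hv⟩
  obtain ⟨d, -, h1, h2⟩ := w.exists_boundary_dart {z | p z.1} hpu hpv
  rcases (d.adj : P.Covers _ _ ∨ P.Covers _ _) with h | h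
  · exact ⟨_, d.fst.2, _, d.snd.2, h, Or.inl ⟨h1, h2⟩⟩
  · exact ⟨_, d.snd.2, _, d.fst.2, h, Or.inr ⟨h2, h1⟩⟩

/-! ### Translates of tubes and finiteness up to translation -/

/-- The translate of a finite set by `k` periods. -/
def shift (n : ℕ) (k : ℤ) (τ : Finset ℤ) : Finset ℤ := τ.image fun i => i + k * n

theorem mem_shift {k j : ℤ} {τ : Finset ℤ} : j ∈ shift n k τ ↔ j - k * n ∈ τ := by
  simp only [shift, Finset.mem_image]
  constructor
  · rintro ⟨i, hi, rfl⟩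
    simpa using hi
  · exact fun h => ⟨_, h, by ring⟩

theorem shift_shift (k l : ℤ) (τ : Finset ℤ) : shift n k (shift n l τ) = shift n (k + l) τ := by
  ext j
  simp only [mem_shift]
  ring_nf

theorem shift_zero (τ : Finset ℤ) : shift n 0 τ = τ := by
  ext j
  simp [mem_shift]

theorem card_shift (k : ℤ) (τ : Finset ℤ) : (shift n k τ).card = τ.card :=
  Finset.card_image_of_injective _ fun i j h => by simpa using h

variable {P}

theorem ordConvex_shift {k : ℤ} {τ : Finset ℤ} (h : P.OrdConvex τ) :
    P.OrdConvex (shift n k τ : Finset ℤ) := by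
  intro a ha c hc b hab hbc
  simp only [Finset.mem_coe, mem_shift] at *
  have h1 := (P.le_add_mul_iff (-k) _ _).mpr hab
  have h2 := (P.le_add_mul_iff (-k) _ _).mpr hbc
  rw [neg_mul, ← sub_eq_add_neg, ← sub_eq_add_neg] at h1 h2
  exact h _ ha _ hc _ h1 h2

theorem connected_shift {k : ℤ} {τ : Finset ℤ}
    (h : (P.hasseDiagram.induce (τ : Set ℤ)).Connected) :
    (P.hasseDiagram.induce (shift n k τ : Set ℤ)).Connected := by
  let φ : P.hasseDiagram →g P.hasseDiagram :=
    ⟨fun i => i + k * n, fun {a b} hab =>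
      Or.imp (P.covers_add_mul_iff k _ _).mpr (P.covers_add_mul_iff k _ _).mpr hab⟩
  have hmap : Set.MapsTo φ (τ : Set ℤ) (shift n k τ : Set ℤ) := fun i hi => by
    change i + k * n ∈ AffinePoset.shift n k τ
    rw [mem_shift, add_sub_cancel_right]
    exact hi
  have hsurj : ∀ u : (shift n k τ : Set ℤ), ∃ v : (τ : Set ℤ),
      SimpleGraph.induceHom φ hmap v = u := by
    rintro ⟨u, hu⟩
    refine ⟨⟨u - k * n, mem_shift.mp hu⟩, Subtype.ext ?_⟩
    exact sub_add_cancel u (k * n)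
  have : Nonempty (shift n k τ : Set ℤ) := h.nonempty.map (SimpleGraph.induceHom φ hmap)
  refine ⟨fun u v => ?_⟩
  obtain ⟨u', rfl⟩ := hsurj u
  obtain ⟨v', rfl⟩ := hsurj v
  exact (h.preconnected u' v').map _

theorem isProperTube_iff {τ : Finset ℤ} : P.IsProperTube τ ↔
    (P.hasseDiagram.induce (τ : Set ℤ)).Connected ∧ P.OrdConvex τ ∧ 2 ≤ τ.card ∧
      ∀ i ∈ τ, ∀ j ∈ τ, i ≡ j [ZMOD n] → i = j := by
  constructor
  · rintro ⟨⟨h1, h2, h3, h4⟩, h5⟩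
    refine ⟨h1, h2, ?_, h4.resolve_left h5⟩
    rw [Set.encard_coe_eq_coe_finsetCard] at h3
    exact_mod_cast h3
  · rintro ⟨h1, h2, h3, h4⟩
    refine ⟨⟨h1, h2, ?_, Or.inr h4⟩, fun h => ?_⟩
    · rw [Set.encard_coe_eq_coe_finsetCard]
      exact_mod_cast h3
    · exact Set.infinite_univ (h ▸ τ.finite_toSet)

namespace IsProperTube

variable {τ : Finset ℤ}

theorem conn (h : P.IsProperTube τ) : (P.hasseDiagram.induce (τ : Set ℤ)).Connected :=
  (isProperTube_iff.mp h).1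

theorem ordConvex (h : P.IsProperTube τ) : P.OrdConvex τ := (isProperTube_iff.mp h).2.1

theorem two_le_card (h : P.IsProperTube τ) : 2 ≤ τ.card := (isProperTube_iff.mp h).2.2.1

theorem eq_of_modEq (h : P.IsProperTube τ) {i j : ℤ} (hi : i ∈ τ) (hj : j ∈ τ)
    (hij : i ≡ j [ZMOD n]) : i = j := (isProperTube_iff.mp h).2.2.2 i hi j hj hij

theorem eq_zero_of_mem (h : P.IsProperTube τ) {i k : ℤ} (hi : i ∈ τ) (hj : i + k * n ∈ τ) :
    k = 0 := by
  have := h.eq_of_modEq hi hj (by simp [Int.ModEq])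
  have hn := P.cast_pos
  have h0 : k * n = 0 := by linarith
  exact (mul_eq_zero.mp h0).resolve_right hn.ne'

theorem nonempty (h : P.IsProperTube τ) : τ.Nonempty :=
  Finset.card_pos.mp (by have := h.two_le_card; omega)

theorem shift (h : P.IsProperTube τ) (k : ℤ) : P.IsProperTube (shift n k τ) := by
  refine isProperTube_iff.mpr ⟨connected_shift h.conn, ordConvex_shift h.ordConvex, ?_, ?_⟩
  · rw [card_shift]; exact h.two_le_card
  · intro i hi j hj hij
    rw [mem_shift] at hi hj
    have := h.eq_of_modEq hi hj (hij.sub_right _)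
    linarith

end IsProperTube

theorem card_le_of_residues (hn : 0 < n) {τ : Finset ℤ}
    (h : ∀ i ∈ τ, ∀ j ∈ τ, i ≡ j [ZMOD n] → i = j) : τ.card ≤ n := by
  have hn' : (0 : ℤ) < n := by exact_mod_cast hn
  have := Finset.card_le_card_of_injOn (s := τ) (t := Finset.Ico (0 : ℤ) n) (fun i => i % n)
    (fun i _ => by simp [Int.emod_nonneg _ hn'.ne', Int.emod_lt_of_pos _ hn'])
    (fun i hi j hj hij => h i hi j hj hij)
  simpa using this

theorem IsProperTube.card_le {τ : Finset ℤ} (h : P.IsProperTube τ) : τ.card ≤ n :=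
  card_le_of_residues P.pos fun _ hi _ hj => h.eq_of_modEq hi hj

theorem IsProperTube.exists_shift_meets {τ : Finset ℤ} (h : P.IsProperTube τ) :
    ∃ k : ℤ, ∃ i ∈ AffinePoset.shift n k τ, 0 ≤ i ∧ i < n := by
  obtain ⟨i, hi⟩ := h.nonempty
  have hn := P.cast_pos
  refine ⟨-(i / n), i % n, ?_, Int.emod_nonneg _ hn.ne', Int.emod_lt_of_pos _ hn⟩
  rw [mem_shift]
  convert hi using 1
  have := Int.emod_add_mul_ediv i n
  linear_combination this

variable (P) in
-- Covering relations have bounded length `C` as integers, and a proper tube is connected with at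
-- most `n` elements, so it stays within distance `n * C` of any of its elements.
theorem finite_tubes_meeting : {τ | P.IsProperTube τ ∧ ∃ i ∈ τ, 0 ≤ i ∧ i < n}.Finite := by
  obtain ⟨C, hC⟩ := P.exists_covers_bound
  refine (Finset.finite_toSet (Finset.Icc (-(n * C : ℤ)) (n + n * C)).powerset).subset ?_
  rintro τ ⟨hτ, i, hi, hi0, hin⟩
  simp only [Finset.coe_powerset, Set.mem_preimage, Set.mem_powerset_iff, Finset.coe_subset]
  intro j hj
  obtain ⟨w, hw⟩ := hτ.conn.exists_isPath ⟨i, hi⟩ ⟨j, hj⟩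
  have hlen := hw.length_lt
  rw [← Nat.card_eq_fintype_card, Nat.card_coe_set_eq, Set.ncard_coe_finset] at hlen
  have key : ∀ (u v : (τ : Set ℤ)) (w : (P.hasseDiagram.induce (τ : Set ℤ)).Walk u v),
      (u.1 - v.1).natAbs ≤ w.length * C := by
    intro u v w
    induction w with
    | nil => simp
    | @cons u v w' huv p ih =>
      have h1 : (u.1 - v.1).natAbs ≤ C := by
        rcases (huv : P.Covers _ _ ∨ P.Covers _ _) with h | h
        · exact hC _ _ h
        · rw [← Int.natAbs_neg, neg_sub]; exact hC _ _ h
      rw [SimpleGraph.Walk.length_cons, add_mul, one_mul]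
      omega
  have h1 := key _ _ w
  have h2 : w.length * C ≤ n * C := Nat.mul_le_mul_right _ (hlen.le.trans hτ.card_le)
  have h3 : (i - j).natAbs ≤ n * C := h1.trans h2
  rw [Finset.mem_Icc]
  zify at h3
  rw [abs_le] at h3
  constructor <;> linarith

end AffinePoset

/-! ### The functionals `α_τ` -/

namespace AffinePoset

variable {n : ℕ} {P : AffinePoset n}

open Classical in
/-- The covering relations inside a finite set. -/
noncomputable def edges (P : AffinePoset n) (τ : Finset ℤ) : Finset (ℤ × ℤ) :=
  (τ ×ˢ τ).filter fun e => P.Covers e.1 e.2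

theorem mem_edges {τ : Finset ℤ} {e : ℤ × ℤ} :
    e ∈ P.edges τ ↔ e.1 ∈ τ ∧ e.2 ∈ τ ∧ P.Covers e.1 e.2 := by
  simp [edges, and_assoc]

theorem alphaSeq_apply (τ : Finset ℤ) (x : ℤ → ℝ) :
    P.alphaSeq τ x = ∑ e ∈ P.edges τ, (x e.2 - x e.1) := by
  simp [alphaSeq, edges, LinearMap.sum_apply]

theorem alphaSeq_congr {τ : Finset ℤ} {x y : ℤ → ℝ} {d : ℝ} (h : ∀ i ∈ τ, x i = y i + d) :
    P.alphaSeq τ x = P.alphaSeq τ y := by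
  rw [alphaSeq_apply, alphaSeq_apply]
  refine Finset.sum_congr rfl fun e he => ?_
  rw [mem_edges] at he
  rw [h _ he.1, h _ he.2.1]
  ring

theorem alphaSeq_shift (k : ℤ) (τ : Finset ℤ) (x : ℤ → ℝ) :
    P.alphaSeq (shift n k τ) x = P.alphaSeq τ fun i => x (i + k * n) := by
  rw [alphaSeq_apply, alphaSeq_apply]
  symm
  refine Finset.sum_bij (fun e _ => (e.1 + k * n, e.2 + k * n)) ?_ ?_ ?_ ?_
  · intro e he
    rw [mem_edges] at he ⊢
    simpa [mem_shift, P.covers_add_mul_iff] using he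
  · rintro ⟨a, b⟩ - ⟨a', b'⟩ - h
    simpa using h
  · rintro ⟨a, b⟩ he
    rw [mem_edges] at he
    refine ⟨(a - k * n, b - k * n), ?_, by simp⟩
    rw [mem_edges]
    refine ⟨mem_shift.mp he.1, mem_shift.mp he.2.1, ?_⟩
    rw [← P.covers_add_mul_iff k]
    simpa using he.2.2
  · exact fun _ _ => rfl

theorem affineMaps_apply {c : ℝ} {x : ℤ → ℝ} (hx : x ∈ affineMaps n c) (k i : ℤ) :
    x (i + k * n) = x i + k * c := by
  induction k using Int.induction_on with
  | zero => simp
  | succ k ih =>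
    have := hx (i + k * n)
    rw [show i + ((k : ℤ) + 1) * n = i + k * n + n by ring, this, ih]
    push_cast; ring
  | pred k ih =>
    have := hx (i + (-(k : ℤ) - 1) * n)
    rw [show i + (-(k : ℤ) - 1) * n + n = i + -k * n by ring, ih] at this
    push_cast at this ⊢; linarith

theorem alphaSeq_shift_of_affine {c : ℝ} {x : ℤ → ℝ} (hx : x ∈ affineMaps n c) (k : ℤ)
    (τ : Finset ℤ) : P.alphaSeq (shift n k τ) x = P.alphaSeq τ x := by
  rw [alphaSeq_shift]
  exact alphaSeq_congr fun i _ => affineMaps_apply hx k i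

theorem le_alphaSeq {τ : Finset ℤ} {x : ℤ → ℝ} (hx : ∀ e ∈ P.edges τ, x e.1 ≤ x e.2)
    {e : ℤ × ℤ} (he : e ∈ P.edges τ) : x e.2 - x e.1 ≤ P.alphaSeq τ x := by
  rw [alphaSeq_apply]
  exact Finset.single_le_sum (f := fun e : ℤ × ℤ => x e.2 - x e.1)
    (fun e he => sub_nonneg.mpr (hx e he)) he

/-- On a connected set, a sequence increasing along covering relations oscillates by at most the
sum of its increments. -/
theorem sub_le_alphaSeq {τ : Finset ℤ} {x : ℤ → ℝ}
    (hc : (P.hasseDiagram.induce (τ : Set ℤ)).Connected)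
    (hx : ∀ e ∈ P.edges τ, x e.1 ≤ x e.2) {i j : ℤ} (hi : i ∈ τ) (hj : j ∈ τ) :
    x j - x i ≤ P.alphaSeq τ x := by
  classical
  let F : Sym2 ℤ → ℝ := Sym2.lift ⟨fun a b => |x a - x b|, fun a b => abs_sub_comm _ _⟩
  let g : ℤ × ℤ → Sym2 ℤ := fun e => s(e.1, e.2)
  -- A path uses each undirected edge at most once, so its absolute increments are among the
  -- nonnegative terms of `α_τ`. Unordered pairs are used because the path may descend.
  obtain ⟨w, hw⟩ := hc.exists_isPath ⟨i, hi⟩ ⟨j, hj⟩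
  have key : ∀ (u v : (τ : Set ℤ)) (w : (P.hasseDiagram.induce (τ : Set ℤ)).Walk u v),
      x v.1 - x u.1 ≤ ((w.edges.map (Sym2.map Subtype.val)).map F).sum := by
    intro u v w
    induction w with
    | nil => simp
    | @cons u v w' huv p ih =>
      have h1 : x v.1 - x u.1 ≤ F s(u.1, v.1) := by
        simp only [F, Sym2.lift_mk]
        rw [abs_sub_comm]
        exact le_abs_self _
      simp only [SimpleGraph.Walk.edges_cons, List.map_cons, List.sum_cons, Sym2.map_mk]
      linarith
  have hnd : (w.edges.map (Sym2.map Subtype.val)).Nodup :=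
    hw.isTrail.edges_nodup.map (Sym2.map.injective Subtype.val_injective)
  refine (key _ _ w).trans ?_
  rw [← List.sum_toFinset F hnd, alphaSeq_apply]
  have hsub : (w.edges.map (Sym2.map Subtype.val)).toFinset ⊆ (P.edges τ).image g := by
    intro s hs
    rw [List.mem_toFinset, List.mem_map] at hs
    obtain ⟨s, hs, rfl⟩ := hs
    have hadj := w.edges_subset_edgeSet hs
    induction s with
    | _ u v =>
    rw [Finset.mem_image]
    rcases (hadj : P.Covers _ _ ∨ P.Covers _ _) with h | h
    · exact ⟨(u.1, v.1), mem_edges.mpr ⟨u.2, v.2, h⟩, rfl⟩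
    · exact ⟨(v.1, u.1), mem_edges.mpr ⟨v.2, u.2, h⟩, Sym2.eq_swap⟩
  have hnonneg : ∀ s, 0 ≤ F s := by
    intro s
    induction s with
    | _ u v => exact abs_nonneg _
  refine (Finset.sum_le_sum_of_subset_of_nonneg hsub fun s _ _ => hnonneg s).trans ?_
  rw [Finset.sum_image]
  · refine Finset.sum_le_sum fun e he => ?_
    simp only [F, g, Sym2.lift_mk]
    rw [abs_sub_comm, abs_of_nonneg (sub_nonneg.mpr (hx e he))]
  · rintro ⟨a, b⟩ hab ⟨c, d⟩ hcd h
    rcases Sym2.eq_iff.mp h with ⟨h1, h2⟩ | ⟨h1, h2⟩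
    · exact Prod.ext h1 h2
    · have h3 := (mem_edges.mp hab).2.2
      have h4 := (mem_edges.mp hcd).2.2
      simp only at h1 h2 h3 h4
      subst h1 h2
      exact absurd (P.order.le_antisymm _ _ h3.le h4.le) h3.ne

/-- By antisymmetry the edges and their reversals are disjoint sets of off-diagonal pairs. The extra
`τ.card` later gives a strict inequality. -/
theorem two_mul_card_edges_le (τ : Finset ℤ) :
    2 * (P.edges τ).card + τ.card ≤ τ.card * τ.card := by
  classical
  have hdis : Disjoint (P.edges τ) ((P.edges τ).image Prod.swap) := by
    rw [Finset.disjoint_left]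
    rintro ⟨a, b⟩ h1 h2
    rw [Finset.mem_image] at h2
    obtain ⟨⟨c, d⟩, h2, h3⟩ := h2
    obtain ⟨rfl, rfl⟩ := Prod.mk.inj h3
    have h4 := (mem_edges.mp h1).2.2
    have h5 := (mem_edges.mp h2).2.2
    exact h4.ne (P.order.le_antisymm _ _ h4.le h5.le)
  have hsub : P.edges τ ∪ (P.edges τ).image Prod.swap ⊆ τ.offDiag := by
    refine Finset.union_subset (fun e he => ?_) fun e he => ?_
    · have := mem_edges.mp he
      exact Finset.mem_offDiag.mpr ⟨this.1, this.2.1, this.2.2.ne⟩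
    · rw [Finset.mem_image] at he
      obtain ⟨e, he, rfl⟩ := he
      have := mem_edges.mp he
      exact Finset.mem_offDiag.mpr ⟨this.2.1, this.1, this.2.2.ne.symm⟩
  have hcard := Finset.card_le_card hsub
  rw [Finset.card_union_of_disjoint hdis, Finset.card_image_of_injective _ Prod.swap_injective,
    Finset.offDiag_card] at hcard
  have : τ.card ≤ τ.card * τ.card := Nat.le_mul_self _
  omega

/-- The sequences satisfying all the inequalities `α_τ ≥ n ^ (2 |τ|)`. -/
def feasible (P : AffinePoset n) : Set (ℤ → ℝ) :=
  {x | x ∈ affineMaps n ((n : ℝ) ^ (2 * (n + 1))) ∧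
    ∀ τ, P.IsProperTube τ → (n : ℝ) ^ (2 * τ.card) ≤ P.alphaSeq τ x}

/-- The proper tubes whose inequality is an equality. -/
def tightTubes (P : AffinePoset n) (x : ℤ → ℝ) : Set (Finset ℤ) :=
  {τ | P.IsProperTube τ ∧ P.alphaSeq τ x = (n : ℝ) ^ (2 * τ.card)}

/-- A covering relation between incongruent elements is a proper tube. -/
theorem isProperTube_pair {i j : ℤ} (h : P.Covers i j) (hij : ¬ i ≡ j [ZMOD n]) :
    P.IsProperTube {i, j} := by
  refine isProperTube_iff.mpr ⟨?_, ?_, ?_, ?_⟩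
  · rw [Finset.coe_pair]
    exact SimpleGraph.induce_pair_connected_of_adj (Or.inl h)
  · intro a ha c hc b hab hbc
    simp only [Finset.coe_pair, Set.mem_insert_iff, Set.mem_singleton_iff] at *
    rcases ha with rfl | rfl <;> rcases hc with rfl | rfl
    · exact Or.inl (P.order.le_antisymm _ _ hbc hab)
    · exact (P.covers_iff.mp h).2 _ hab hbc
    · exact absurd (P.order.le_antisymm _ _ h.le (P.order.le_trans _ _ _ hab hbc)) h.ne
    · exact Or.inr (P.order.le_antisymm _ _ hbc hab)
  · rw [Finset.card_pair h.ne]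
  · intro a ha b hb hab
    simp only [Finset.mem_insert, Finset.mem_singleton] at ha hb
    rcases ha with rfl | rfl <;> rcases hb with rfl | rfl
    · rfl
    · exact absurd hab hij
    · exact absurd hab.symm hij
    · rfl

theorem alphaSeq_pair {i j : ℤ} (h : P.Covers i j) (x : ℤ → ℝ) :
    P.alphaSeq {i, j} x = x j - x i := by
  have : P.edges {i, j} = {(i, j)} := by
    ext ⟨a, b⟩
    simp only [mem_edges, Finset.mem_insert, Finset.mem_singleton, Prod.mk.injEq]
    constructor
    · rintro ⟨rfl | rfl, rfl | rfl, hab⟩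
      · exact absurd rfl hab.ne
      · exact ⟨rfl, rfl⟩
      · exact absurd (P.order.le_antisymm _ _ h.le hab.le) h.ne
      · exact absurd rfl hab.ne
    · rintro ⟨rfl, rfl⟩
      exact ⟨Or.inl rfl, Or.inr rfl, h⟩
  rw [alphaSeq_apply, this, Finset.sum_singleton]

/-- A sequence with nonnegative increments on proper tubes and nonnegative period is monotone. -/
theorem monotone_of_alphaSeq_nonneg {c : ℝ} (hc : 0 ≤ c) {x : ℤ → ℝ} (hx : x ∈ affineMaps n c)
    (h : ∀ τ, P.IsProperTube τ → 0 ≤ P.alphaSeq τ x) {i j : ℤ} (hij : P.order.le i j) :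
    x i ≤ x j := by
  refine P.monotone_of_covers (fun i j hij => ?_) hij
  -- A pair of congruent elements is not a tube; for such a covering relation the increment is a
  -- nonnegative multiple of the period constant.
  by_cases hmod : i ≡ j [ZMOD n]
  · obtain ⟨k, hk⟩ := hmod.dvd
    have hj : j = i + k * n := by linear_combination hk
    have hk0 : 0 ≤ k := by
      by_contra hneg
      have := P.le_add_mul j (k := -k) (by omega)
      rw [hj, show i + k * n + -k * n = i by ring, ← hj] at this
      exact hij.ne (P.order.le_antisymm _ _ hij.le this)
    rw [hj, affineMaps_apply hx]
    have : 0 ≤ (k : ℝ) * c := mul_nonneg (by exact_mod_cast hk0) hc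
    linarith
  · have := h _ (isProperTube_pair hij hmod)
    rw [alphaSeq_pair hij] at this
    linarith

end AffinePoset

/-! ### Tight tubes form a proper tubing -/

namespace AffinePoset

variable {n : ℕ} {P : AffinePoset n}

theorem exists_hull (P : AffinePoset n) (S : Finset ℤ) : ∃ ρ : Finset ℤ, ∀ c, c ∈ ρ ↔
    ∃ u ∈ S, ∃ v ∈ S, P.order.le u c ∧ P.order.le c v := by
  have hfin : {c | ∃ u ∈ S, ∃ v ∈ S, P.order.le u c ∧ P.order.le c v}.Finite := by
    have : {c | ∃ u ∈ S, ∃ v ∈ S, P.order.le u c ∧ P.order.le c v} =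
        ⋃ u ∈ (S : Set ℤ), ⋃ v ∈ (S : Set ℤ), {c | P.order.le u c ∧ P.order.le c v} := by
      ext c
      simp only [Set.mem_ofPred_eq, Set.mem_iUnion, exists_prop, Finset.mem_coe]
    rw [this]
    exact S.finite_toSet.biUnion fun u _ => S.finite_toSet.biUnion fun v _ =>
      P.finite_interval u v
  exact ⟨hfin.toFinset, fun c => by simp⟩

theorem reachable_mono {S T : Set ℤ} (h : S ⊆ T) {u v : ℤ} (hu : u ∈ S) (hv : v ∈ S)
    (huv : (P.hasseDiagram.induce S).Reachable ⟨u, hu⟩ ⟨v, hv⟩) :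
    (P.hasseDiagram.induce T).Reachable ⟨u, h hu⟩ ⟨v, h hv⟩ :=
  huv.map (SimpleGraph.induceHomOfLE P.hasseDiagram h).toHom

theorem feasible_monotone {x : ℤ → ℝ} (hx : x ∈ P.feasible) {i j : ℤ} (h : P.order.le i j) :
    x i ≤ x j :=
  monotone_of_alphaSeq_nonneg (by positivity) hx.1
    (fun τ hτ => le_trans (by positivity) (hx.2 τ hτ)) h

theorem tight_sub_le {x : ℤ → ℝ} (hx : x ∈ P.feasible) {σ : Finset ℤ}
    (hσ : σ ∈ P.tightTubes x) {i j : ℤ} (hi : i ∈ σ) (hj : j ∈ σ) :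
    x j - x i ≤ (n : ℝ) ^ (2 * σ.card) :=
  (sub_le_alphaSeq hσ.1.conn
    (fun _ he => feasible_monotone hx (mem_edges.mp he).2.2.le) hi hj).trans hσ.2.le

/-- Two comparable tight tubes that are not nested are separated by the values of the sequence. -/
theorem tight_separated {x : ℤ → ℝ} (hx : x ∈ P.feasible) {σ τ : Finset ℤ}
    (hσ : σ ∈ P.tightTubes x) (hτ : τ ∈ P.tightTubes x) (h1 : ¬ σ ⊆ τ) (h2 : ¬ τ ⊆ σ)
    {a b : ℤ} (ha : a ∈ σ) (hb : b ∈ τ) (hab : P.order.le a b)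
    {a' b' : ℤ} (ha' : a' ∈ σ) (hb' : b' ∈ τ) : x a' < x b' := by
  by_contra hcon
  rw [not_lt] at hcon
  have hxab := feasible_monotone hx hab
  have hn2 : 2 ≤ n := hσ.1.two_le_card.trans hσ.1.card_le
  have hN : (2 : ℝ) ≤ n := by exact_mod_cast hn2
  set N : ℝ := (n : ℝ) with hNdef
  obtain ⟨ρ, hρ⟩ := P.exists_hull (σ ∪ τ)
  set m := max σ.card τ.card with hm
  have hpow : ∀ {k l : ℕ}, k ≤ l → N ^ (2 * k) ≤ N ^ (2 * l) := fun hkl =>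
    pow_le_pow_right₀ (by linarith) (by omega)
  have hσm : N ^ (2 * σ.card) ≤ N ^ (2 * m) := hpow (le_max_left _ _)
  have hτm : N ^ (2 * τ.card) ≤ N ^ (2 * m) := hpow (le_max_right _ _)
  -- Each tight tube oscillates by at most `N ^ (2 * m)`. Passing between them costs nothing: `x a ≤
  -- x b` bounds differences from `τ` to `σ`, and the assumption `x b' ≤ x a'` those from `σ` to
  -- `τ`.
  have hspread : ∀ u ∈ σ ∪ τ, ∀ v ∈ σ ∪ τ, x v - x u ≤ 2 * N ^ (2 * m) := by
    intro u hu v hv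
    have hpos : 0 ≤ N ^ (2 * m) := by positivity
    rw [Finset.mem_union] at hu hv
    rcases hu with hu | hu <;> rcases hv with hv | hv
    · have := tight_sub_le hx hσ hu hv
      linarith
    · have e1 := tight_sub_le hx hσ hu ha'
      have e2 := tight_sub_le hx hτ hb' hv
      linarith
    · have e1 := tight_sub_le hx hτ hu hb
      have e2 := tight_sub_le hx hσ ha hv
      linarith
    · have := tight_sub_le hx hτ hu hv
      linarith
  have hspreadρ : ∀ u ∈ ρ, ∀ v ∈ ρ, x v - x u ≤ 2 * N ^ (2 * m) := by
    intro u hu v hv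
    obtain ⟨u0, hu0, -, -, hle, -⟩ := (hρ u).mp hu
    obtain ⟨-, -, v0, hv0, -, hle'⟩ := (hρ v).mp hv
    have := hspread u0 hu0 v0 hv0
    have := feasible_monotone hx hle
    have := feasible_monotone hx hle'
    linarith
  have hsub : σ ∪ τ ⊆ ρ := fun u hu =>
    (hρ u).mpr ⟨u, hu, u, hu, P.order.le_refl u, P.order.le_refl u⟩
  have hσρ : σ ⊆ ρ := Finset.subset_union_left.trans hsub
  have hτρ : τ ⊆ ρ := Finset.subset_union_right.trans hsub
  have hcard : m + 1 ≤ ρ.card := by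
    have e1 : σ.card < ρ.card :=
      Finset.card_lt_card ⟨hσρ, fun h => h2 (hτρ.trans h)⟩
    have e2 : τ.card < ρ.card :=
      Finset.card_lt_card ⟨hτρ, fun h => h1 (hσρ.trans h)⟩
    omega
  have hpm : 0 < N ^ (2 * m) := by positivity
  -- With distinct residues the hull is a proper tube, whose few edges with small increments
  -- contradict its own inequality. Otherwise it contains two elements a positive number of periods
  -- apart, and the period constant exceeds the spread.
  by_cases hres : ∀ i ∈ ρ, ∀ j ∈ ρ, i ≡ j [ZMOD n] → i = j
  · have hconv : P.OrdConvex (ρ : Set ℤ) := by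
      intro u hu w hw v huv hvw
      obtain ⟨u0, hu0, -, -, hle, -⟩ := (hρ u).mp hu
      obtain ⟨-, -, w0, hw0, -, hle'⟩ := (hρ w).mp hw
      exact (hρ v).mpr ⟨u0, hu0, w0, hw0, P.order.le_trans _ _ _ hle huv,
        P.order.le_trans _ _ _ hvw hle'⟩
    have hreach : ∀ u (hu : u ∈ (ρ : Set ℤ)),
        (P.hasseDiagram.induce (ρ : Set ℤ)).Reachable ⟨a, hσρ ha⟩ ⟨u, hu⟩ := by
      have hστ : ∀ u (hu : u ∈ σ ∪ τ),
          (P.hasseDiagram.induce (ρ : Set ℤ)).Reachable ⟨a, hσρ ha⟩ ⟨u, hsub hu⟩ := by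
        intro u hu
        rcases Finset.mem_union.mp hu with hu | hu
        · exact reachable_mono (Finset.coe_subset.mpr hσρ) ha hu
            (hσ.1.conn.preconnected ⟨a, ha⟩ ⟨u, hu⟩)
        · exact (P.reachable_of_le hconv (hσρ ha) (hτρ hb) hab).trans
            (reachable_mono (Finset.coe_subset.mpr hτρ) hb hu
              (hτ.1.conn.preconnected ⟨b, hb⟩ ⟨u, hu⟩))
      intro u hu
      obtain ⟨u0, hu0, -, -, hle, -⟩ := (hρ u).mp hu
      exact (hστ u0 hu0).trans (P.reachable_of_le hconv (hsub hu0) hu hle)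
    have hconn : (P.hasseDiagram.induce (ρ : Set ℤ)).Connected := by
      have : Nonempty (ρ : Set ℤ) := ⟨⟨a, hσρ ha⟩⟩
      exact ⟨fun u v => (hreach u.1 u.2).symm.trans (hreach v.1 v.2)⟩
    have htube : P.IsProperTube ρ := by
      refine isProperTube_iff.mpr ⟨hconn, hconv, ?_, hres⟩
      have := hσ.1.two_le_card
      have := Finset.card_le_card hσρ
      omega
    have hfeas := hx.2 ρ htube
    have hcn := htube.card_le
    have hedge := two_mul_card_edges_le (P := P) ρ
    have hedge' : 2 * ((P.edges ρ).card : ℝ) < N ^ 2 := by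
      have h3 : ρ.card * ρ.card ≤ n * n := Nat.mul_le_mul hcn hcn
      have h4 : 2 * (P.edges ρ).card < n ^ 2 := by rw [sq]; omega
      rw [hNdef]
      exact_mod_cast h4
    have hsum : P.alphaSeq ρ x ≤ (P.edges ρ).card * (2 * N ^ (2 * m)) := by
      rw [alphaSeq_apply, ← nsmul_eq_mul]
      refine Finset.sum_le_card_nsmul _ _ _ fun e he => ?_
      rw [mem_edges] at he
      exact hspreadρ _ he.1 _ he.2.1
    have h5 : N ^ 2 * N ^ (2 * m) ≤ N ^ (2 * ρ.card) := by
      rw [← pow_add, show 2 + 2 * m = 2 * (m + 1) by ring]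
      exact hpow hcard
    nlinarith
  · push Not at hres
    obtain ⟨i, hi, j, hj, hij, hne⟩ := hres
    have hmn : m ≤ n := max_le hσ.1.card_le hτ.1.card_le
    have hbig : 2 * N ^ (2 * m) < N ^ (2 * (n + 1)) := by
      have e1 : N ^ (2 * (n + 1)) = N ^ 2 * N ^ (2 * n) := by ring
      have e2 := hpow hmn
      have e3 : (4 : ℝ) ≤ N ^ 2 := by nlinarith
      have e4 := mul_le_mul_of_nonneg_right e3 (hpm.le.trans e2)
      linarith
    have key : ∀ i ∈ ρ, ∀ k : ℤ, 1 ≤ k → i + k * n ∉ ρ := by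
      intro i hi k hk hj
      have e1 := hspreadρ i hi _ hj
      rw [affineMaps_apply hx.1] at e1
      have e2 : (1 : ℝ) ≤ k := by exact_mod_cast hk
      have e3 : 0 ≤ N ^ (2 * (n + 1)) := by positivity
      have e4 := mul_le_mul_of_nonneg_right e2 e3
      linarith
    obtain ⟨k, hk⟩ := hij.dvd
    rcases lt_trichotomy k 0 with h0 | h0 | h0
    · refine key j hj (-k) (by omega) ?_
      convert hi using 1
      linear_combination hk
    · rw [h0] at hk
      exact hne (by linarith)
    · refine key i hi k (by omega) ?_
      convert hj using 1
      linear_combination -hk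

/-- The tight tubes of a feasible sequence form a proper tubing. -/
theorem isProperTubing_tightTubes {x : ℤ → ℝ} (hx : x ∈ P.feasible) :
    P.IsProperTubing (P.tightTubes x) where
  proper := fun τ hτ => hτ.1
  periodic := fun τ hτ k => by
    refine ⟨hτ.1.shift k, ?_⟩
    have h1 := alphaSeq_shift_of_affine (P := P) hx.1 k τ
    have h2 := card_shift (n := n) k τ
    rw [shift] at h1 h2
    rw [h1, h2, hτ.2]
  nested_or_disjoint := fun σ hσ τ hτ => by
    by_contra hcon
    push Not at hcon
    obtain ⟨h1, h2, h3⟩ := hcon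
    obtain ⟨c, hc, hc'⟩ := Finset.not_disjoint_iff.mp h3
    exact lt_irrefl _ (tight_separated hx hσ hτ h1 h2 hc hc' (P.order.le_refl c) hc hc')
  acyclic := by
    have step : ∀ σ τ, σ ∈ P.tightTubes x ∧ τ ∈ P.tightTubes x ∧ P.Precedes σ τ →
        ∀ a ∈ σ, ∀ b ∈ τ, x a < x b := by
      rintro σ τ ⟨hσ, hτ, hdis, a, ha, b, hb, hab⟩ a' ha' b' hb'
      refine tight_separated hx hσ hτ (fun h => ?_) (fun h => ?_) ha hb (P.lt_iff.mp hab).1 ha' hb'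
      · exact Finset.disjoint_left.mp hdis ha (h ha)
      · exact Finset.disjoint_left.mp hdis (h hb) hb
    have main : ∀ σ τ, Relation.TransGen
        (fun σ ρ => σ ∈ P.tightTubes x ∧ ρ ∈ P.tightTubes x ∧ P.Precedes σ ρ) σ τ →
        ∀ a ∈ σ, ∀ b ∈ τ, x a < x b := by
      intro σ τ h
      induction h with
      | single h => exact step _ _ h
      | tail _ h ih =>
        intro a ha b hb
        obtain ⟨c, hc⟩ := h.1.1.nonempty
        exact (ih a ha c hc).trans (step _ _ h c hc b hb)
    intro τ hτ hcyc
    obtain ⟨a, ha⟩ := hτ.1.nonempty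
    exact lt_irrefl _ (main τ τ hcyc a ha a ha)

end AffinePoset

/-! ### Contraction of a tubing: splittings and heights -/

namespace AffinePoset

variable {n : ℕ} {P : AffinePoset n}

/-- The preorder generated by the affine poset and by contracting the sets in `T`. -/
def ContractedLe (P : AffinePoset n) (T : Set (Finset ℤ)) : ℤ → ℤ → Prop :=
  Relation.ReflTransGen fun i j => P.order.le i j ∨ ∃ τ ∈ T, i ∈ τ ∧ j ∈ τ

theorem contractedLe_of_le {T : Set (Finset ℤ)} {i j : ℤ} (h : P.order.le i j) :
    P.ContractedLe T i j := Relation.ReflTransGen.single (Or.inl h)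

theorem contractedLe_of_mem {T : Set (Finset ℤ)} {τ : Finset ℤ} (hτ : τ ∈ T) {i j : ℤ}
    (hi : i ∈ τ) (hj : j ∈ τ) : P.ContractedLe T i j :=
  Relation.ReflTransGen.single (Or.inr ⟨τ, hτ, hi, hj⟩)

/-- A periodic collection is infinite, but cardinalities are at most `n`, so increasing chains stop.
-/
theorem exists_maximal_superset {T : Set (Finset ℤ)} (hT : ∀ τ ∈ T, τ.card ≤ n)
    {ρ : Finset ℤ} (hρ : ρ ∈ T) : ∃ σ, ρ ⊆ σ ∧ Maximal (· ∈ T) σ := by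
  induction hk : n - ρ.card using Nat.strong_induction_on generalizing ρ with
  | _ k ih =>
  by_cases hmax : Maximal (· ∈ T) ρ
  · exact ⟨ρ, subset_rfl, hmax⟩
  · have : ∃ μ ∈ T, ρ ⊂ μ := by
      by_contra hcon
      push Not at hcon
      refine hmax ⟨hρ, fun μ hμ hle => ?_⟩
      by_contra hnot
      exact hcon μ hμ ⟨hle, hnot⟩
    obtain ⟨μ, hμ, hss⟩ := this
    have h1 := Finset.card_lt_card hss
    have h2 := hT μ hμ
    obtain ⟨σ, hσ, hmaxσ⟩ := ih (n - μ.card) (by omega) hμ rfl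
    exact ⟨σ, hss.1.trans hσ, hmaxσ⟩

namespace IsProperTubing

variable {T : Set (Finset ℤ)}

theorem eq_or_disjoint_of_maximal (hT : P.IsProperTubing T) {T' : Set (Finset ℤ)} (hT' : T' ⊆ T)
    {σ τ : Finset ℤ} (hσ : Maximal (· ∈ T') σ) (hτ : Maximal (· ∈ T') τ) :
    σ = τ ∨ Disjoint σ τ := by
  rcases hT.nested_or_disjoint σ (hT' hσ.1) τ (hT' hτ.1) with h | h | h
  · exact Or.inl (hσ.eq_of_le hτ.1 h)
  · exact Or.inl (hτ.eq_of_le hσ.1 h).symm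
  · exact Or.inr h

/-- Normal form of a chain in the contraction: each passage through a tube is absorbed into a
maximal tube of `T'`. Distinct maximal tubes are disjoint, so successive ones are related by
`Precedes`, which is where acyclicity can later apply. -/
theorem contractedLe_cases (hT : P.IsProperTubing T) {T' : Set (Finset ℤ)} (hT' : T' ⊆ T)
    {p q : ℤ} (h : P.ContractedLe T' p q) : P.order.le p q ∨
      ∃ σ τ, Maximal (· ∈ T') σ ∧ Maximal (· ∈ T') τ ∧
        Relation.ReflTransGen (fun σ ρ => σ ∈ T ∧ ρ ∈ T ∧ P.Precedes σ ρ) σ τ ∧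
        (∃ s ∈ σ, P.order.le p s) ∧ ∃ t ∈ τ, P.order.le t q := by
  induction h with
  | refl => exact Or.inl (P.order.le_refl p)
  | @tail q r _ hstep ih =>
    rcases hstep with hqr | ⟨ρ₀, hρ₀, hq, hr⟩
    · rcases ih with ih | ⟨σ, τ, hσ, hτ, hst, hs, t, ht, htq⟩
      · exact Or.inl (P.order.le_trans _ _ _ ih hqr)
      · exact Or.inr ⟨σ, τ, hσ, hτ, hst, hs, t, ht, P.order.le_trans _ _ _ htq hqr⟩
    · obtain ⟨ρ, hsub, hρ⟩ := exists_maximal_superset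
        (fun τ hτ => (hT.proper τ (hT' hτ)).card_le) hρ₀
      right
      rcases ih with ih | ⟨σ, τ, hσ, hτ, hst, hs, t, ht, htq⟩
      · exact ⟨ρ, ρ, hρ, hρ, .refl, ⟨q, hsub hq, ih⟩, r, hsub hr, P.order.le_refl r⟩
      · refine ⟨σ, ρ, hσ, hρ, ?_, hs, r, hsub hr, P.order.le_refl r⟩
        rcases hT.eq_or_disjoint_of_maximal hT' hτ hρ with rfl | hdis
        · exact hst
        · refine hst.tail ⟨hT' hτ.1, hT' hρ.1, hdis, t, ht, q, hsub hq, P.lt_iff.mpr ⟨htq, ?_⟩⟩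
          rintro rfl
          exact Finset.disjoint_left.mp hdis ht (hsub hq)

/-- In the contraction of an acyclic collection, comparable elements are only identified if they
lie in a common tube. -/
theorem exists_mem_of_contractedLe (hT : P.IsProperTubing T) {T' : Set (Finset ℤ)} (hT' : T' ⊆ T)
    {a b : ℤ} (hab : P.order.lt a b) (h : P.ContractedLe T' b a) :
    ∃ τ ∈ T', a ∈ τ ∧ b ∈ τ := by
  rw [P.lt_iff] at hab
  rcases hT.contractedLe_cases hT' h with hba | ⟨σ, τ, hσ, hτ, hst, ⟨s, hs, hbs⟩, t, ht, hta⟩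
  · exact absurd (P.order.le_antisymm _ _ hab.1 hba) hab.2
  · rcases hT.eq_or_disjoint_of_maximal hT' hσ hτ with rfl | hdis
    · have hc := (hT.proper σ (hT' hσ.1)).ordConvex
      exact ⟨σ, hσ.1, hc t ht s hs a hta (P.order.le_trans _ _ _ hab.1 hbs),
        hc t ht s hs b (P.order.le_trans _ _ _ hta hab.1) hbs⟩
    · exfalso
      have hts : P.order.lt t s := by
        refine P.lt_iff.mpr ⟨P.order.le_trans _ _ _ hta (P.order.le_trans _ _ _ hab.1 hbs), ?_⟩
        rintro rfl
        exact Finset.disjoint_left.mp hdis hs ht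
      exact hT.acyclic τ (hT' hτ.1) (Relation.TransGen.head'
        ⟨hT' hτ.1, hT' hσ.1, hdis.symm, t, ht, s, hs, hts⟩ hst)

/-- A finite convex set compatible with a tubing can be cut into a lower and an upper part without
cutting any smaller tube of the tubing. -/
theorem exists_split (hT : P.IsProperTubing T) {S : Finset ℤ} (hS : P.OrdConvex (S : Set ℤ))
    (hcard : 2 ≤ S.card) (hcompat : ∀ τ ∈ T, τ ⊆ S ∨ S ⊆ τ ∨ Disjoint τ S) :
    ∃ B U : Finset ℤ, B ∪ U = S ∧ Disjoint B U ∧ B.Nonempty ∧ U.Nonempty ∧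
      P.OrdConvex (B : Set ℤ) ∧ P.OrdConvex (U : Set ℤ) ∧
      (∀ i ∈ U, ∀ j ∈ B, ¬ P.order.le i j) ∧
      (∀ τ ∈ T, τ ⊂ S → τ ⊆ B ∨ τ ⊆ U) ∧
      (∀ τ ∈ T, τ ⊆ B ∨ B ⊆ τ ∨ Disjoint τ B) ∧ (∀ τ ∈ T, τ ⊆ U ∨ U ⊆ τ ∨ Disjoint τ U) := by
  classical
  let T' : Set (Finset ℤ) := {τ | τ ∈ T ∧ τ ⊂ S}
  have hT' : T' ⊆ T := fun τ hτ => hτ.1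
  let pre : Preorder ℤ :=
    { le := P.ContractedLe T'
      lt := fun a b => P.ContractedLe T' a b ∧ ¬ P.ContractedLe T' b a
      le_refl := fun _ => Relation.ReflTransGen.refl
      le_trans := fun _ _ _ => Relation.ReflTransGen.trans }
  have hSne : S.Nonempty := Finset.card_pos.mp (by omega)
  -- The lower part is the class of a minimal element after contracting the tubes strictly inside
  -- `S`: the maximal such tube containing `m`, or `{m}` if there is none.
  obtain ⟨m, hmS, hmin⟩ := @Finset.exists_minimal ℤ pre.toLE ⟨fun _ _ _ h h' => pre.le_trans _ _ _ h' h⟩ S hSne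
  have hmin' : ∀ a ∈ S, P.ContractedLe T' a m → P.ContractedLe T' m a := fun a ha h => hmin ha h
  have hB : ∃ B : Finset ℤ, m ∈ B ∧ B ⊂ S ∧ P.OrdConvex (B : Set ℤ) ∧
      (∀ j ∈ B, P.ContractedLe T' j m) ∧ ∀ τ ∈ T', τ ⊆ B ∨ Disjoint τ B := by
    by_cases hex : ∃ ρ ∈ T', m ∈ ρ
    · obtain ⟨ρ, hρ, hmρ⟩ := hex
      obtain ⟨B, hρB, hBmax⟩ := exists_maximal_superset
        (fun τ hτ => (hT.proper τ (hT' hτ)).card_le) hρ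
      refine ⟨B, hρB hmρ, hBmax.1.2, (hT.proper B hBmax.1.1).ordConvex,
        fun j hj => contractedLe_of_mem hBmax.1 hj (hρB hmρ), fun τ hτ => ?_⟩
      rcases hT.nested_or_disjoint τ hτ.1 B hBmax.1.1 with h | h | h
      · exact Or.inl h
      · exact Or.inl (hBmax.2 hτ h)
      · exact Or.inr h
    · refine ⟨{m}, Finset.mem_singleton_self m, ?_, ?_, ?_, fun τ hτ => Or.inr ?_⟩
      · refine ⟨by simpa using hmS, fun h => ?_⟩
        have := Finset.card_le_card h
        rw [Finset.card_singleton] at this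
        omega
      · intro a ha c hc b hab hbc
        simp only [Finset.coe_singleton, Set.mem_singleton_iff] at *
        subst ha hc
        exact P.order.le_antisymm _ _ hbc hab
      · intro j hj
        rw [Finset.mem_singleton] at hj
        subst hj
        exact Relation.ReflTransGen.refl
      · rw [Finset.disjoint_singleton_right]
        exact fun h => hex ⟨τ, hτ, h⟩
  obtain ⟨B, hmB, hBS, hBconv, hBm, hBT⟩ := hB
  have hno : ∀ i ∈ S \ B, ∀ j ∈ B, ¬ P.order.le i j := by
    intro i hi j hj hij
    rw [Finset.mem_sdiff] at hi
    have hlt : P.order.lt i j := P.lt_iff.mpr ⟨hij, fun h => hi.2 (h ▸ hj)⟩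
    have h1 : P.ContractedLe T' i m := (contractedLe_of_le hij).trans (hBm j hj)
    -- Minimality of `m` identifies `i` and `j` in the contraction, so some tube of `T'` contains
    -- both and would be cut by `B`.
    have h2 : P.ContractedLe T' j i := (hBm j hj).trans (hmin' i hi.1 h1)
    obtain ⟨τ, hτ, hiτ, hjτ⟩ := hT.exists_mem_of_contractedLe hT' hlt h2
    rcases hBT τ hτ with h | h
    · exact hi.2 (h hiτ)
    · exact Finset.disjoint_left.mp h hjτ hj
  have hsplit : ∀ τ ∈ T, τ ⊂ S → τ ⊆ B ∨ τ ⊆ S \ B := by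
    intro τ hτ hss
    exact (hBT τ ⟨hτ, hss⟩).imp id fun h => Finset.subset_sdiff.mpr ⟨hss.1, h⟩
  have hUne : (S \ B).Nonempty := Finset.sdiff_nonempty.mpr hBS.2
  have hcases : ∀ τ ∈ T, τ ⊆ B ∨ τ ⊆ S \ B ∨ S ⊆ τ ∨ Disjoint τ S := by
    intro τ hτ
    rcases hcompat τ hτ with h | h | h
    · by_cases hSτ : S ⊆ τ
      · exact Or.inr (Or.inr (Or.inl hSτ))
      · exact (hsplit τ hτ ⟨h, hSτ⟩).imp id Or.inl
    · exact Or.inr (Or.inr (Or.inl h))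
    · exact Or.inr (Or.inr (Or.inr h))
  refine ⟨B, S \ B, Finset.union_sdiff_of_subset hBS.1, Finset.disjoint_sdiff, ⟨m, hmB⟩, hUne,
    hBconv, ?_, hno, hsplit, fun τ hτ => ?_, fun τ hτ => ?_⟩
  · intro a ha c hc b hab hbc
    rw [Finset.mem_coe] at *
    rw [Finset.mem_sdiff]
    refine ⟨hS a (Finset.mem_sdiff.mp ha).1 c (Finset.mem_sdiff.mp hc).1 b hab hbc, fun hb => ?_⟩
    exact hno a ha b hb hab
  · rcases hcases τ hτ with h | h | h | h
    · exact Or.inl h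
    · exact Or.inr (Or.inr (Finset.disjoint_of_subset_left h Finset.sdiff_disjoint))
    · exact Or.inr (Or.inl (hBS.1.trans h))
    · exact Or.inr (Or.inr (Finset.disjoint_of_subset_right hBS.1 h))
  · rcases hcases τ hτ with h | h | h | h
    · exact Or.inr (Or.inr (Finset.disjoint_of_subset_left h Finset.disjoint_sdiff))
    · exact Or.inl h
    · exact Or.inr (Or.inl (Finset.sdiff_subset.trans h))
    · exact Or.inr (Or.inr (Finset.disjoint_of_subset_right Finset.sdiff_subset h))

theorem shift_mem (hT : P.IsProperTubing T) {τ : Finset ℤ} (hτ : τ ∈ T) (k : ℤ) :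
    shift n k τ ∈ T := hT.periodic τ hτ k

theorem shift_mem_iff (hT : P.IsProperTubing T) {τ : Finset ℤ} (k : ℤ) :
    shift n k τ ∈ T ↔ τ ∈ T := by
  refine ⟨fun h => ?_, fun h => hT.shift_mem h k⟩
  have := hT.shift_mem h (-k)
  rwa [shift_shift, neg_add_cancel, shift_zero] at this

theorem contractedLe_add_mul (hT : P.IsProperTubing T) (k : ℤ) {p q : ℤ}
    (h : P.ContractedLe T p q) : P.ContractedLe T (p + k * n) (q + k * n) := by
  refine Relation.ReflTransGen.lift (fun i => i + k * n) (fun i j hij => ?_) _ _ h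
  rcases hij with hij | ⟨τ, hτ, hi, hj⟩
  · exact Or.inl ((P.le_add_mul_iff k _ _).mpr hij)
  · exact Or.inr ⟨shift n k τ, hT.shift_mem hτ k, by simpa [mem_shift] using hi,
      by simpa [mem_shift] using hj⟩

/-- A monotone integer-valued function, increasing by one over each period, that does not
separate the elements of any tube of the tubing. -/
theorem exists_height (hT : P.IsProperTubing T) : ∃ h : ℤ → ℤ,
    (∀ i j, P.order.le i j → h i ≤ h j) ∧ (∀ i k : ℤ, h (i + k * n) = h i + k) ∧
      ∀ τ ∈ T, ∀ i ∈ τ, ∀ j ∈ τ, h i = h j := by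
  -- The height of `i` is the last multiple of `n` below it in the contraction. Were these multiples
  -- unbounded, two of them would be identified and hence lie in one proper tube, against
  -- distinctness of residues.
  have hex : ∀ i : ℤ, ∃ m : ℤ, P.ContractedLe T (m * n) i ∧
      ∀ k : ℤ, P.ContractedLe T (k * n) i → k ≤ m := by
    intro i
    refine Int.exists_greatest_of_bdd ?_ ?_
    · obtain ⟨m, hm⟩ := P.stronglyConnected i 0
      rw [zero_add] at hm
      refine ⟨m, fun k hk => ?_⟩
      by_contra hcon
      have hle : P.order.le (m * n) (k * n) := by
        have := P.le_add_mul (m * n) (k := k - m) (by omega)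
        rwa [show m * (n : ℤ) + (k - m) * n = k * n by ring] at this
      have hne : m * (n : ℤ) ≠ k * n := fun h =>
        hcon (mul_right_cancel₀ P.cast_pos.ne' h).ge
      obtain ⟨τ, hτ, h1, h2⟩ := hT.exists_mem_of_contractedLe subset_rfl
        (P.lt_iff.mpr ⟨hle, hne⟩) (hk.trans (contractedLe_of_le hm))
      have := (hT.proper τ hτ).eq_zero_of_mem (i := m * n) (k := k - m) h1 (by
        rwa [show m * (n : ℤ) + (k - m) * n = k * n by ring])
      omega
    · obtain ⟨k, hk⟩ := P.stronglyConnected 0 i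
      refine ⟨-k, contractedLe_of_le ?_⟩
      have := (P.le_add_mul_iff (-k) _ _).mpr hk
      rwa [zero_add, show i + k * n + -k * (n : ℤ) = i by ring] at this
  choose h hP hmax using hex
  have hmono : ∀ i j, P.ContractedLe T i j → h i ≤ h j := fun i j hij =>
    hmax j _ ((hP i).trans hij)
  have hge : ∀ i k : ℤ, h i + k ≤ h (i + k * n) := by
    intro i k
    apply hmax
    rw [add_mul]
    exact hT.contractedLe_add_mul k (hP i)
  refine ⟨h, fun i j hij => hmono i j (contractedLe_of_le hij), fun i k => ?_,
    fun τ hτ i hi j hj => le_antisymm (hmono _ _ (contractedLe_of_mem hτ hi hj))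
      (hmono _ _ (contractedLe_of_mem hτ hj hi))⟩
  have := hge (i + k * n) (-k)
  rw [show i + k * n + -k * (n : ℤ) = i by ring] at this
  exact le_antisymm (by linarith) (hge i k)

end IsProperTubing

end AffinePoset

/-! ### Recursive solution on a finite convex block -/

/-- Here `s` is the set of edges crossing a cut, `d` their increments before the upper part is
raised by `D`, and `A` the sum of the inner increments. `D` is found by solving for total `a * u`.
The condition `4 * s.card ≤ a` leaves each crossing edge an increment at least `u` despite the
variation of `d`. -/
theorem exists_gap {ι : Type*} (s : Finset ι) (d : ι → ℝ) {A u a p q : ℝ} (hu : 0 ≤ u)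
    (hd : ∀ c ∈ s, -p ≤ d c ∧ d c ≤ q) (hp : 0 ≤ p) (hpq : p + q ≤ 2 * u)
    (hA : 0 ≤ A) (hA' : A ≤ u) (ha : 4 ≤ a) (hs : 4 * (s.card : ℝ) ≤ a) :
    ∃ D : ℝ, 0 ≤ D ∧ (∀ c ∈ s, u ≤ d c + D) ∧ D + q ≤ 2 * (a * u) ∧
      A + ∑ c ∈ s, (d c + D) ≤ a * u ∧ (s.Nonempty → A + ∑ c ∈ s, (d c + D) = a * u) := by
  have hau : 4 * u ≤ a * u := mul_le_mul_of_nonneg_right ha hu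
  rcases s.eq_empty_or_nonempty with rfl | hne
  · exact ⟨0, le_rfl, by simp, by linarith, by simpa using by linarith, by simp⟩
  have he : (1 : ℝ) ≤ s.card := by exact_mod_cast hne.card_pos
  set e : ℝ := (s.card : ℝ) with hedef
  have hX1 : -(e * p) ≤ ∑ c ∈ s, d c := by
    have := s.card_nsmul_le_sum d (-p) fun c hc => (hd c hc).1
    rw [nsmul_eq_mul] at this
    linarith
  have hX2 : ∑ c ∈ s, d c ≤ e * q := by
    have := s.sum_le_card_nsmul d q fun c hc => (hd c hc).2
    rwa [nsmul_eq_mul] at this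
  set X := ∑ c ∈ s, d c with hX
  set D := (a * u - A - X) / e with hD
  have heD : e * D = a * u - A - X := by
    rw [hD]
    field_simp
  have hlow : p + u ≤ D := by
    rw [hD, le_div_iff₀ (by linarith)]
    have h1 : e * (p + q) ≤ e * (2 * u) := mul_le_mul_of_nonneg_left hpq (by linarith)
    have h2 : 3 * e * u ≤ (a - 1) * u := mul_le_mul_of_nonneg_right (by linarith) hu
    linarith
  have hup : D ≤ a * u + p := by
    rw [hD, div_le_iff₀ (by linarith)]
    have h1 : 1 * (a * u) ≤ e * (a * u) := mul_le_mul_of_nonneg_right he (by linarith)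
    linarith
  have hsum : A + ∑ c ∈ s, (d c + D) = a * u := by
    rw [Finset.sum_add_distrib, Finset.sum_const, nsmul_eq_mul, ← hX, ← hedef, heD]
    ring
  refine ⟨D, by linarith, fun c hc => ?_, by linarith, hsum.le, fun _ => hsum⟩
  have := (hd c hc).1
  linarith

namespace AffinePoset

variable {n : ℕ} {P : AffinePoset n}

/-- The value of `α` aimed for on a convex set with `k` elements. -/
noncomputable def weight (n k : ℕ) : ℝ := if k ≤ 1 then 0 else (n : ℝ) ^ (2 * k)

theorem weight_nonneg (n k : ℕ) : 0 ≤ weight n k := by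
  unfold weight
  split_ifs <;> positivity

theorem weight_le (n k : ℕ) : weight n k ≤ (n : ℝ) ^ (2 * k) := by
  unfold weight
  split_ifs
  · positivity
  · exact le_rfl

/-- Giving weight `0` to singletons is what makes the case `p = 1` or `q = 1` true. In the other
cases both cardinalities are at most `p + q - 2`, and a factor `n ^ 2 ≥ 4` is left to absorb the sum
of two terms. -/
theorem weight_add_weight_le (hn : 2 ≤ n) {p q : ℕ} (hp : 1 ≤ p) (hq : 1 ≤ q) :
    weight n p + weight n q ≤ (n : ℝ) ^ (2 * (p + q - 1)) := by
  have hN : (2 : ℝ) ≤ n := by exact_mod_cast hn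
  rcases hp.eq_or_lt with rfl | hp
  · have := weight_le n q
    rw [show 1 + q - 1 = q by omega]
    simpa [weight] using this
  rcases hq.eq_or_lt with rfl | hq
  · have := weight_le n p
    rw [show p + 1 - 1 = p by omega]
    simpa [weight] using this
  have h1 : ∀ k ≤ p + q - 2, weight n k ≤ (n : ℝ) ^ (2 * (p + q - 2)) := fun k hk =>
    (weight_le n k).trans (pow_le_pow_right₀ (by linarith) (by omega))
  have h2 := h1 p (by omega)
  have h3 := h1 q (by omega)
  have h4 : (n : ℝ) ^ (2 * (p + q - 1)) = n ^ 2 * (n : ℝ) ^ (2 * (p + q - 2)) := by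
    rw [← pow_add]
    congr 1
    omega
  have h5 : 0 ≤ (n : ℝ) ^ (2 * (p + q - 2)) := by positivity
  have h6 : (4 : ℝ) ≤ n ^ 2 := by nlinarith
  have h7 := mul_le_mul_of_nonneg_right h6 h5
  linarith

theorem edges_subset {σ τ : Finset ℤ} (h : σ ⊆ τ) : P.edges σ ⊆ P.edges τ := by
  intro e he
  rw [mem_edges] at he ⊢
  exact ⟨h he.1, h he.2.1, he.2.2⟩

/-- A sequence that solves the inequalities of all tubes inside `S`, with equality for the tubes
of `T`, and whose size on `S` is controlled. -/
structure IsAdapted (P : AffinePoset n) (T : Set (Finset ℤ)) (S : Finset ℤ) (x : ℤ → ℝ) :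
    Prop where
  nonneg : ∀ i ∈ S, 0 ≤ x i
  le : ∀ i ∈ S, x i ≤ 2 * weight n S.card
  mono : ∀ e ∈ P.edges S, x e.1 ≤ x e.2
  alpha_le : P.alphaSeq S x ≤ weight n S.card
  le_alpha : ∀ σ, P.IsProperTube σ → σ ⊆ S → (n : ℝ) ^ (2 * σ.card) ≤ P.alphaSeq σ x
  alpha_eq : ∀ τ ∈ T, τ ⊆ S → P.alphaSeq τ x = (n : ℝ) ^ (2 * τ.card)

open Classical in
theorem alphaSeq_union {B U : Finset ℤ} (hdis : Disjoint B U)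
    (hno : ∀ i ∈ U, ∀ j ∈ B, ¬ P.order.le i j) (x : ℤ → ℝ) :
    P.alphaSeq (B ∪ U) x = P.alphaSeq B x + P.alphaSeq U x +
      ∑ e ∈ (P.edges (B ∪ U)).filter (fun e => e.1 ∈ B ∧ e.2 ∈ U), (x e.2 - x e.1) := by
  have hE : P.edges (B ∪ U) = (P.edges B ∪ P.edges U) ∪
      (P.edges (B ∪ U)).filter (fun e => e.1 ∈ B ∧ e.2 ∈ U) := by
    ext e
    simp only [Finset.mem_union, Finset.mem_filter, mem_edges]
    constructor
    · rintro ⟨h1 | h1, h2 | h2, h3⟩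
      · exact Or.inl (Or.inl ⟨h1, h2, h3⟩)
      · exact Or.inr ⟨⟨Or.inl h1, Or.inr h2, h3⟩, h1, h2⟩
      · exact absurd h3.le (hno _ h1 _ h2)
      · exact Or.inl (Or.inr ⟨h1, h2, h3⟩)
    · rintro ((⟨h1, h2, h3⟩ | ⟨h1, h2, h3⟩) | ⟨h, -⟩)
      · exact ⟨Or.inl h1, Or.inl h2, h3⟩
      · exact ⟨Or.inr h1, Or.inr h2, h3⟩
      · exact h
  have hd1 : Disjoint (P.edges B) (P.edges U) := by
    rw [Finset.disjoint_left]
    intro e h1 h2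
    exact Finset.disjoint_left.mp hdis (mem_edges.mp h1).1 (mem_edges.mp h2).1
  have hd2 : Disjoint (P.edges B ∪ P.edges U)
      ((P.edges (B ∪ U)).filter (fun e => e.1 ∈ B ∧ e.2 ∈ U)) := by
    rw [Finset.disjoint_left]
    intro e h1 h2
    have h2 := (Finset.mem_filter.mp h2).2
    rcases Finset.mem_union.mp h1 with h1 | h1
    · exact Finset.disjoint_left.mp hdis (mem_edges.mp h1).2.1 h2.2
    · exact Finset.disjoint_left.mp hdis h2.1 (mem_edges.mp h1).1
  rw [alphaSeq_apply, alphaSeq_apply, alphaSeq_apply, hE, Finset.sum_union hd2,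
    Finset.sum_union hd1, ← hE]

namespace IsProperTubing

variable {T : Set (Finset ℤ)}

theorem exists_isAdapted (hT : P.IsProperTubing T) (hn : 2 ≤ n) {S : Finset ℤ}
    (hS : P.OrdConvex (S : Set ℤ)) (hne : S.Nonempty) (hSn : S.card ≤ n)
    (hcompat : ∀ τ ∈ T, τ ⊆ S ∨ S ⊆ τ ∨ Disjoint τ S) : ∃ x, IsAdapted P T S x := by
  classical
  induction hk : S.card using Nat.strong_induction_on generalizing S with
  | _ k ih =>
  subst hk
  rcases (Nat.succ_le_of_lt hne.card_pos).eq_or_lt with hone | htwo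
  · have hno : ∀ σ : Finset ℤ, P.IsProperTube σ → ¬ σ ⊆ S := fun σ hσ hsub => by
      have := Finset.card_le_card hsub
      have := hσ.two_le_card
      omega
    obtain ⟨m, rfl⟩ := Finset.card_eq_one.mp hone.symm
    exact ⟨0, fun _ _ => le_rfl, fun _ _ => by simpa using weight_nonneg n 1, fun _ _ => le_rfl,
      by simpa using weight_nonneg n 1, fun σ hσ h => absurd h (hno σ hσ),
      fun τ hτ h => absurd h (hno τ (hT.proper τ hτ))⟩
  obtain ⟨B, U, rfl, hdis, hBne, hUne, hB, hU, hno, hsplit, hBc, hUc⟩ :=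
    hT.exists_split hS htwo hcompat
  have hcard := Finset.card_union_of_disjoint hdis
  have hBpos := hBne.card_pos
  have hUpos := hUne.card_pos
  obtain ⟨y, hy⟩ := ih B.card (by omega) hB hBne (by omega) hBc rfl
  obtain ⟨z, hz⟩ := ih U.card (by omega) hU hUne (by omega) hUc rfl
  set cross := (P.edges (B ∪ U)).filter (fun e => e.1 ∈ B ∧ e.2 ∈ U) with hcross
  -- The threshold for crossing edges: the largest bound required of a tube strictly inside `B ∪ U`.
  set u : ℝ := (n : ℝ) ^ (2 * (B.card + U.card - 1)) with hu
  have hN : (2 : ℝ) ≤ n := by exact_mod_cast hn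
  have hwle := weight_add_weight_le hn (show 1 ≤ B.card from hBpos) (show 1 ≤ U.card from hUpos)
  have hu0 : 0 ≤ u := by positivity
  have hau : (n : ℝ) ^ 2 * u = (n : ℝ) ^ (2 * (B ∪ U).card) := by
    rw [hu, ← pow_add]
    congr 1
    omega
  have hwS : weight n (B ∪ U).card = (n : ℝ) ^ (2 * (B ∪ U).card) := if_neg (by omega)
  have hA0 : 0 ≤ P.alphaSeq B y + P.alphaSeq U z := by
    rw [alphaSeq_apply, alphaSeq_apply]
    exact add_nonneg (Finset.sum_nonneg fun e he => sub_nonneg.mpr (hy.mono e he))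
      (Finset.sum_nonneg fun e he => sub_nonneg.mpr (hz.mono e he))
  -- There are at most `|B| |U|` crossing edges, and `4 |B| |U| ≤ (|B| + |U|) ^ 2 ≤ n ^ 2`.
  have hcr : 4 * (cross.card : ℝ) ≤ (n : ℝ) ^ 2 := by
    have h1 : cross.card ≤ B.card * U.card := by
      rw [← Finset.card_product]
      refine Finset.card_le_card fun e he => ?_
      exact Finset.mem_product.mpr (Finset.mem_filter.mp he).2
    have h2 : (cross.card : ℝ) ≤ B.card * U.card := by exact_mod_cast h1
    have h3 : (B.card : ℝ) + U.card ≤ n := by exact_mod_cast hcard ▸ hSn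
    have h4 : (0 : ℝ) ≤ B.card + U.card := by positivity
    nlinarith [sq_nonneg ((B.card : ℝ) - U.card)]
  obtain ⟨D, hD0, hDu, hDup, hsum, hsumeq⟩ := exists_gap cross (fun e => z e.2 - y e.1)
    (A := P.alphaSeq B y + P.alphaSeq U z) (u := u) (a := (n : ℝ) ^ 2)
    (p := 2 * weight n B.card) (q := 2 * weight n U.card) hu0
    (fun e he => by
      have he := (Finset.mem_filter.mp he).2
      have h1 := hy.nonneg _ he.1
      have h2 := hy.le _ he.1
      have h3 := hz.nonneg _ he.2
      have h4 := hz.le _ he.2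
      constructor <;> linarith)
    (by linarith [weight_nonneg n B.card]) (by linarith)
    hA0 (by linarith [hy.alpha_le, hz.alpha_le]) (by nlinarith) hcr
  let x : ℤ → ℝ := fun i => if i ∈ U then z i + D else y i
  have hxU : ∀ i ∈ U, x i = z i + D := fun i hi => if_pos hi
  have hxB : ∀ i ∈ B, x i = y i := fun i hi => if_neg (Finset.disjoint_left.mp hdis hi)
  have hαB : ∀ σ ⊆ B, P.alphaSeq σ x = P.alphaSeq σ y := fun σ hσ =>
    alphaSeq_congr (d := 0) fun i hi => by rw [hxB i (hσ hi), add_zero]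
  have hαU : ∀ σ ⊆ U, P.alphaSeq σ x = P.alphaSeq σ z := fun σ hσ =>
    alphaSeq_congr fun i hi => hxU i (hσ hi)
  have hcrossx : ∀ e ∈ cross, x e.2 - x e.1 = z e.2 - y e.1 + D := by
    intro e he
    have he := (Finset.mem_filter.mp he).2
    rw [hxU _ he.2, hxB _ he.1]
    ring
  have hαS : P.alphaSeq (B ∪ U) x = P.alphaSeq B y + P.alphaSeq U z +
      ∑ e ∈ cross, (z e.2 - y e.1 + D) := by
    rw [alphaSeq_union hdis hno, hαB B subset_rfl, hαU U subset_rfl,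
      Finset.sum_congr rfl hcrossx]
  have hmono : ∀ e ∈ P.edges (B ∪ U), x e.1 ≤ x e.2 := by
    intro e he
    by_cases hec : e ∈ cross
    · have := hDu e hec
      rw [← hcrossx e hec] at this
      linarith
    · obtain ⟨h1, h2, h3⟩ := mem_edges.mp he
      rw [Finset.mem_union] at h1 h2
      rcases h1 with h1 | h1 <;> rcases h2 with h2 | h2
      · rw [hxB _ h1, hxB _ h2]
        exact hy.mono e (mem_edges.mpr ⟨h1, h2, h3⟩)
      · exact absurd (Finset.mem_filter.mpr ⟨he, h1, h2⟩) hec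
      · exact absurd h3.le (hno _ h1 _ h2)
      · rw [hxU _ h1, hxU _ h2]
        have := hz.mono e (mem_edges.mpr ⟨h1, h2, h3⟩)
        linarith
  have hcut : ∀ σ, P.IsProperTube σ → σ ⊆ B ∪ U → ¬ σ ⊆ B → ¬ σ ⊆ U →
      ∃ e ∈ cross, e ∈ P.edges σ := by
    intro σ hσ hsub hσB hσU
    obtain ⟨v, hv, hvB⟩ := Finset.not_subset.mp hσB
    obtain ⟨w, hw, hwU⟩ := Finset.not_subset.mp hσU
    have hwB := (Finset.mem_union.mp (hsub hw)).resolve_right hwU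
    obtain ⟨i, hi, j, hj, hij, h | h⟩ :=
      P.exists_covers_of_cut hσ.conn (· ∈ B) hw hv hwB hvB
    · have hjU := (Finset.mem_union.mp (hsub hj)).resolve_left h.2
      exact ⟨(i, j), Finset.mem_filter.mpr ⟨mem_edges.mpr ⟨hsub hi, hsub hj, hij⟩, h.1, hjU⟩,
        mem_edges.mpr ⟨hi, hj, hij⟩⟩
    · have hiU := (Finset.mem_union.mp (hsub hi)).resolve_left h.1
      exact absurd hij.le (hno i hiU j h.2)
  have hnotB : ¬ B ∪ U ⊆ B := fun h => by
    obtain ⟨v, hv⟩ := hUne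
    exact Finset.disjoint_right.mp hdis hv (h (Finset.mem_union_right _ hv))
  have hnotU : ¬ B ∪ U ⊆ U := fun h => by
    obtain ⟨v, hv⟩ := hBne
    exact Finset.disjoint_left.mp hdis hv (h (Finset.mem_union_left _ hv))
  -- Connectedness of a tube provides a crossing edge, which is needed for raising `U` to reach the
  -- exact value.
  have hfull : P.IsProperTube (B ∪ U) →
      P.alphaSeq (B ∪ U) x = (n : ℝ) ^ (2 * (B ∪ U).card) := by
    intro htube
    obtain ⟨e, he, -⟩ := hcut _ htube subset_rfl hnotB hnotU
    rw [hαS, hsumeq ⟨e, he⟩, hau]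
  refine ⟨x, fun i hi => ?_, fun i hi => ?_, hmono, ?_, fun σ hσ hsub => ?_, fun τ hτ hsub => ?_⟩
  · rcases Finset.mem_union.mp hi with hi | hi
    · rw [hxB i hi]; exact hy.nonneg i hi
    · rw [hxU i hi]; exact add_nonneg (hz.nonneg i hi) hD0
  · rw [hwS, ← hau]
    rcases Finset.mem_union.mp hi with hi | hi
    · rw [hxB i hi]
      have h1 := hy.le i hi
      have h2 := weight_nonneg n U.card
      have h3 : 1 * u ≤ (n : ℝ) ^ 2 * u := mul_le_mul_of_nonneg_right (by nlinarith) hu0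
      linarith
    · rw [hxU i hi]
      have := hz.le i hi
      linarith
  · rw [hwS, ← hau, hαS]
    exact hsum
  · by_cases hσB : σ ⊆ B
    · rw [hαB σ hσB]; exact hy.le_alpha σ hσ hσB
    by_cases hσU : σ ⊆ U
    · rw [hαU σ hσU]; exact hz.le_alpha σ hσ hσU
    rcases eq_or_ne σ (B ∪ U) with rfl | hne'
    · exact (hfull hσ).ge
    · have hlt := Finset.card_lt_card (hsub.ssubset_of_ne hne')
      obtain ⟨e, he, heσ⟩ := hcut σ hσ hsub hσB hσU
      have h1 := le_alphaSeq (fun e he => hmono e (edges_subset hsub he)) heσ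
      have h2 := hDu e he
      rw [← hcrossx e he] at h2
      refine le_trans ?_ (h2.trans h1)
      exact pow_le_pow_right₀ (by linarith) (by omega)
  · rcases eq_or_ne τ (B ∪ U) with rfl | hne'
    · exact hfull (hT.proper _ hτ)
    · rcases hsplit τ hτ (hsub.ssubset_of_ne hne') with h | h
      · rw [hαB τ h]; exact hy.alpha_eq τ hτ h
      · rw [hαU τ h]; exact hz.alpha_eq τ hτ h

end IsProperTubing

end AffinePoset

/-! ### Feasible points of a tubing and independence of its functionals -/

/-- A family of functionals that is triangular with respect to a rank function takes arbitrary
values. -/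
theorem exists_of_triangular {ι V : Type*} [AddCommGroup V] [Module ℝ V] (a : ι → V →ₗ[ℝ] ℝ)
    (r : ι → ℕ) (s : Finset ι)
    (h : ∀ i ∈ s, ∃ w, a i w ≠ 0 ∧ ∀ j ∈ s, j ≠ i → r j ≤ r i → a j w = 0) (c : ι → ℝ) :
    ∃ w, ∀ i ∈ s, a i w = c i := by
  classical
  have key : ∀ t : Finset ι, t ⊆ s → ∃ w, ∀ i ∈ t, a i w = c i := by
    intro t
    induction t using Finset.induction_on_max_value r with
    | empty => exact fun _ => ⟨0, by simp⟩
    | insert i t hit hmax ih =>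
      intro hsub
      obtain ⟨w, hw⟩ := ih ((Finset.subset_insert i t).trans hsub)
      obtain ⟨v, hv, hv'⟩ := h i (hsub (Finset.mem_insert_self i t))
      refine ⟨w + ((c i - a i w) / a i v) • v, fun j hj => ?_⟩
      rw [map_add, map_smul, smul_eq_mul]
      rcases Finset.mem_insert.mp hj with rfl | hj
      · rw [div_mul_cancel₀ _ hv]
        ring
      · rw [hv' j (hsub (Finset.mem_insert_of_mem hj)) (fun h => hit (h ▸ hj)) (hmax j hj),
          hw j hj, mul_zero, add_zero]
  exact key s subset_rfl

namespace AffinePoset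

variable {n : ℕ} {P : AffinePoset n}

theorem nonempty_affineMaps (P : AffinePoset n) (c : ℝ) : (affineMaps n c).Nonempty := by
  have hn : (n : ℝ) ≠ 0 := by exact_mod_cast P.cast_pos.ne'
  refine ⟨fun i => i * (c / n), fun i => ?_⟩
  push_cast
  field_simp

namespace IsProperTubing

variable {T : Set (Finset ℤ)}

/-- Every proper tubing is contained in the set of tight tubes of a feasible sequence. -/
theorem exists_feasible (hT : P.IsProperTubing T) : ∃ X ∈ P.feasible, T ⊆ P.tightTubes X := by
  classical
  by_cases hn : n < 2
  · have hno : ∀ τ, ¬ P.IsProperTube τ := fun τ hτ => by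
      have := hτ.two_le_card
      have := hτ.card_le
      omega
    obtain ⟨x, hx⟩ := P.nonempty_affineMaps ((n : ℝ) ^ (2 * (n + 1)))
    exact ⟨x, ⟨hx, fun τ hτ => absurd hτ (hno τ)⟩, fun τ hτ => absurd (hT.proper τ hτ) (hno τ)⟩
  rw [not_lt] at hn
  have hN : (2 : ℝ) ≤ n := by exact_mod_cast hn
  have hnpos := P.cast_pos
  obtain ⟨h, hmono, hper, hconst⟩ := hT.exists_height
  -- The level set of height `0`: a fundamental domain that is convex and splits no tube of `T`.
  let I : Finset ℤ := (Finset.Ico 0 (n : ℤ)).image fun r => r - h r * n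
  have hI : ∀ i, i ∈ I ↔ h i = 0 := by
    intro i
    simp only [I, Finset.mem_image, Finset.mem_Ico]
    constructor
    · rintro ⟨r, -, rfl⟩
      have := hper r (-h r)
      rw [show r + -h r * (n : ℤ) = r - h r * n by ring] at this
      omega
    · intro hi
      have e := Int.emod_add_mul_ediv i n
      have h1 := hper (i % n) (i / n)
      rw [show i % n + i / n * n = i by linear_combination e, hi] at h1
      refine ⟨i % n, ⟨Int.emod_nonneg _ hnpos.ne', Int.emod_lt_of_pos _ hnpos⟩, ?_⟩
      rw [show h (i % n) = -(i / n) by omega]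
      linear_combination e
  have hIn : I.card ≤ n := by
    refine Finset.card_image_le.trans ?_
    simp
  have hIne : I.Nonempty := ⟨0 - h 0 * n, Finset.mem_image.mpr ⟨0, by simpa using hnpos, rfl⟩⟩
  have hIconv : P.OrdConvex (I : Set ℤ) := by
    intro a ha c hc b hab hbc
    rw [Finset.mem_coe, hI] at *
    have := hmono a b hab
    have := hmono b c hbc
    omega
  have hIcompat : ∀ τ ∈ T, τ ⊆ I ∨ I ⊆ τ ∨ Disjoint τ I := by
    intro τ hτ
    by_cases hd : Disjoint τ I
    · exact Or.inr (Or.inr hd)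
    · obtain ⟨i, hi, hiI⟩ := Finset.not_disjoint_iff.mp hd
      left
      intro j hj
      rw [hI] at hiI ⊢
      rw [← hconst τ hτ i hi j hj, hiI]
  obtain ⟨x, hx⟩ := hT.exists_isAdapted hn hIconv hIne hIn hIcompat
  set c : ℝ := (n : ℝ) ^ (2 * (n + 1)) with hc
  let X : ℤ → ℝ := fun i => x (i - h i * n) + h i * c
  have hX : X ∈ affineMaps n c := by
    intro i
    have h1 := hper i 1
    rw [one_mul] at h1
    simp only [X, h1]
    rw [show i + (n : ℤ) - (h i + 1) * n = i - h i * n by ring]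
    push_cast
    ring
  have hred : ∀ i, i - h i * n ∈ I := by
    intro i
    rw [hI, sub_eq_add_neg, ← neg_mul, hper, add_neg_cancel]
  have hXI : ∀ σ ⊆ I, P.alphaSeq σ X = P.alphaSeq σ x := fun σ hσ =>
    alphaSeq_congr (d := 0) fun i hi => by
      simp [X, (hI i).mp (hσ hi)]
  have hsame : ∀ i j, P.Covers i j → h i = h j → X i ≤ X j := by
    intro i j hij heq
    have he : (i - h i * n, j - h j * n) ∈ P.edges I := by
      refine mem_edges.mpr ⟨hred i, hred j, ?_⟩
      have := (P.covers_add_mul_iff (-h i) i j).mpr hij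
      rw [← heq]
      rwa [neg_mul, ← sub_eq_add_neg, ← sub_eq_add_neg] at this
    have := hx.mono _ he
    simp only [X]
    rw [heq] at this ⊢
    simpa using this
  have hpn : 0 ≤ (n : ℝ) ^ (2 * n) := by positivity
  -- Changing level adds at least `c`, at least four times `n ^ (2 * n)`, while values on `I` lie
  -- between `0` and twice that power. One such edge satisfies the inequality of any proper tube
  -- meeting several levels.
  have hdiff : ∀ i j, P.Covers i j → h i ≠ h j → (n : ℝ) ^ (2 * n) ≤ X j - X i := by
    intro i j hij hne
    have hle := hmono i j hij.le
    have h1 : (1 : ℝ) ≤ h j - h i := by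
      have : 1 ≤ h j - h i := by omega
      exact_mod_cast this
    have hc0 : 0 ≤ c := by positivity
    have h2 := mul_le_mul_of_nonneg_right h1 hc0
    have h3 := hx.nonneg _ (hred j)
    have h4 := hx.le _ (hred i)
    have h5 : weight n I.card ≤ (n : ℝ) ^ (2 * n) :=
      (weight_le n I.card).trans (pow_le_pow_right₀ (by linarith) (by omega))
    have h6 : c = (n : ℝ) ^ 2 * (n : ℝ) ^ (2 * n) := by rw [hc]; ring
    have h7 : 4 * (n : ℝ) ^ (2 * n) ≤ (n : ℝ) ^ 2 * (n : ℝ) ^ (2 * n) :=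
      mul_le_mul_of_nonneg_right (by nlinarith) hpn
    simp only [X]
    linarith
  have hXmono : ∀ i j, P.Covers i j → X i ≤ X j := by
    intro i j hij
    by_cases heq : h i = h j
    · exact hsame i j hij heq
    · linarith [hdiff i j hij heq]
  have hlevel : ∀ σ : Finset ℤ, ∀ k : ℤ, (∀ i ∈ σ, h i = k) →
      shift n (-k) σ ⊆ I ∧ P.alphaSeq σ X = P.alphaSeq (shift n (-k) σ) x := by
    intro σ k hk
    have hsub : shift n (-k) σ ⊆ I := by
      intro i hi
      have h1 := hk _ (mem_shift.mp hi)
      rw [hI]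
      rw [sub_eq_add_neg, ← neg_mul, neg_neg, hper] at h1
      omega
    exact ⟨hsub, by rw [← hXI _ hsub, alphaSeq_shift_of_affine hX]⟩
  refine ⟨X, ⟨hX, fun σ hσ => ?_⟩, fun τ hτ => ⟨hT.proper τ hτ, ?_⟩⟩
  · obtain ⟨i₀, hi₀⟩ := hσ.nonempty
    by_cases hk : ∀ i ∈ σ, h i = h i₀
    · obtain ⟨h1, h2⟩ := hlevel σ _ hk
      have := hx.le_alpha _ (hσ.shift _) h1
      rwa [card_shift, ← h2] at this
    · push Not at hk
      obtain ⟨v, hv, hvne⟩ := hk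
      obtain ⟨i, hi, j, hj, hij, hp⟩ :=
        P.exists_covers_of_cut hσ.conn (fun i => h i = h i₀) hi₀ hv rfl hvne
      have hne : h i ≠ h j := by
        rcases hp with ⟨h1, h2⟩ | ⟨h1, h2⟩
        · exact fun e => h2 (e ▸ h1)
        · exact fun e => h1 (e.trans h2)
      have h1 := hdiff i j hij hne
      have h2 := le_alphaSeq (x := X) (fun e he => hXmono _ _ (mem_edges.mp he).2.2)
        (mem_edges.mpr ⟨hi, hj, hij⟩ : (i, j) ∈ P.edges σ)
      refine le_trans (pow_le_pow_right₀ (by linarith) ?_) (h1.trans h2)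
      have := hσ.card_le
      omega
  · obtain ⟨i₀, hi₀⟩ := (hT.proper τ hτ).nonempty
    obtain ⟨h1, h2⟩ := hlevel τ _ fun i hi => hconst τ hτ i hi i₀ hi₀
    rw [h2, hx.alpha_eq _ (hT.shift_mem hτ _) h1, card_shift]

/-- For every tube of a tubing there is a periodic sequence with nonzero `α` on that tube and
vanishing `α` on all the other tubes, up to translation, that are not larger. -/
theorem exists_periodic (hT : P.IsProperTubing T) {τ : Finset ℤ} (hτ : τ ∈ T) :
    ∃ y ∈ affineMaps n 0, P.alphaSeq τ y ≠ 0 ∧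
      ∀ σ ∈ T, σ.card ≤ τ.card → (∀ k, σ ≠ shift n k τ) → P.alphaSeq σ y = 0 := by
  classical
  have htube := hT.proper τ hτ
  obtain ⟨B, U, hBU, hdis, hBne, hUne, -, -, hno, hsplit, -, -⟩ :=
    hT.exists_split htube.ordConvex htube.two_le_card (fun σ hσ => by
      rcases hT.nested_or_disjoint σ hσ τ hτ with h | h | h
      · exact Or.inl h
      · exact Or.inr (Or.inl h)
      · exact Or.inr (Or.inr h))
  have hUτ : U ⊆ τ := hBU ▸ Finset.subset_union_right
  have hBτ : B ⊆ τ := hBU ▸ Finset.subset_union_left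
  -- The indicator of all translates of the upper part. A tube of `T` no larger than `τ`, and not a
  -- translate of it, either avoids these translates or has a translate strictly inside `τ`, hence
  -- within `B` or `U`; in each case `y` is constant on it.
  let y : ℤ → ℝ := fun i => if ∃ k : ℤ, i + k * n ∈ U then 1 else 0
  have hy : y ∈ affineMaps n 0 := by
    intro i
    have : (∃ k : ℤ, i + n + k * n ∈ U) ↔ ∃ k : ℤ, i + k * n ∈ U := by
      constructor
      · rintro ⟨k, hk⟩
        exact ⟨k + 1, by rwa [show i + (k + 1) * (n : ℤ) = i + n + k * n by ring]⟩
      · rintro ⟨k, hk⟩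
        exact ⟨k - 1, by rwa [show i + n + (k - 1) * (n : ℤ) = i + k * n by ring]⟩
    simp only [y, this, add_zero]
  have hyτ : ∀ i ∈ τ, y i = if i ∈ U then 1 else 0 := by
    intro i hi
    have : (∃ k : ℤ, i + k * n ∈ U) ↔ i ∈ U := by
      constructor
      · rintro ⟨k, hk⟩
        have := htube.eq_zero_of_mem hi (hUτ hk)
        simpa [this] using hk
      · exact fun h => ⟨0, by simpa using h⟩
    simp only [y, this]
  have hymono : ∀ e ∈ P.edges τ, y e.1 ≤ y e.2 := by
    intro e he
    obtain ⟨h1, h2, h3⟩ := mem_edges.mp he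
    rw [hyτ _ h1, hyτ _ h2]
    by_cases h1U : e.1 ∈ U
    · have h2U : e.2 ∈ U := by
        by_contra hcon
        rw [← hBU, Finset.mem_union] at h2
        exact hno _ h1U _ (h2.resolve_right hcon) h3.le
      simp [h1U, h2U]
    · rw [if_neg h1U]
      split_ifs <;> norm_num
  have hzero : ∀ σ : Finset ℤ, (∃ d, ∀ i ∈ σ, y i = d) → P.alphaSeq σ y = 0 := by
    rintro σ ⟨d, hd⟩
    rw [alphaSeq_congr (y := 0) (d := d) fun i hi => by simp [hd i hi], map_zero]
  refine ⟨y, hy, ?_, fun σ hσ hcard hne => ?_⟩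
  · obtain ⟨u, hu⟩ := hUne
    obtain ⟨b, hb⟩ := hBne
    have hbU := Finset.disjoint_left.mp hdis hb
    obtain ⟨i, hi, j, hj, hij, hp⟩ :=
      P.exists_covers_of_cut htube.conn (· ∈ U) (hUτ hu) (hBτ hb) hu hbU
    have he : (i, j) ∈ P.edges τ := mem_edges.mpr ⟨hi, hj, hij⟩
    have h1 := le_alphaSeq hymono he
    have h2 := hymono _ he
    have h3 : y j - y i ≠ 0 := by
      rw [hyτ _ hi, hyτ _ hj]
      rcases hp with ⟨h1, h2⟩ | ⟨h1, h2⟩ <;> simp [h1, h2]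
    have h4 : 0 < y j - y i := lt_of_le_of_ne (sub_nonneg.mpr h2) (Ne.symm h3)
    exact (h4.trans_le h1).ne'
  · by_cases hmeet : ∃ i ∈ σ, ∃ k : ℤ, i + k * n ∈ U
    · obtain ⟨i, hi, k, hk⟩ := hmeet
      rw [← alphaSeq_shift_of_affine hy k σ]
      have hiσ : i + k * n ∈ shift n k σ := by rw [mem_shift]; simpa using hi
      have hcs := card_shift (n := n) k σ
      have hneq : shift n k σ ≠ τ := by
        rintro rfl
        refine hne (-k) ?_
        rw [shift_shift, neg_add_cancel, shift_zero]
      have hss : shift n k σ ⊂ τ := by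
        rcases hT.nested_or_disjoint _ (hT.shift_mem hσ k) τ hτ with h | h | h
        · exact h.ssubset_of_ne hneq
        · exact absurd (Finset.eq_of_subset_of_card_le h (by omega)).symm hneq
        · exact absurd (hUτ hk) (Finset.disjoint_left.mp h hiσ)
      apply hzero
      rcases hsplit _ (hT.shift_mem hσ k) hss with h | h
      · exact ⟨0, fun j hj => by rw [hyτ j (hss.1 hj), if_neg (Finset.disjoint_left.mp hdis (h hj))]⟩
      · exact ⟨1, fun j hj => by rw [hyτ j (hss.1 hj), if_pos (h hj)]⟩
    · push Not at hmeet
      exact hzero σ ⟨0, fun i hi => if_neg fun ⟨k, hk⟩ => hmeet i hi k hk⟩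

end IsProperTubing

end AffinePoset

/-! ### The direction space and its dimension -/

namespace AffinePoset

variable {n : ℕ}

/-- Periodic sequences. -/
def periodicMaps (n : ℕ) : Submodule ℝ (ℤ → ℝ) where
  carrier := affineMaps n 0
  add_mem' := fun {x y} hx hy i => by simp [hx i, hy i]
  zero_mem' := fun i => by simp
  smul_mem' := fun r x hx i => by simp [hx i]

theorem mem_periodicMaps {y : ℤ → ℝ} : y ∈ periodicMaps n ↔ y ∈ affineMaps n 0 := Iff.rfl

/-- Periodic sequences are determined by their values on one period. -/
def periodicMapsEquiv (hn : 0 < n) : periodicMaps n ≃ₗ[ℝ] (Fin n → ℝ) where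
  toFun y k := y.1 k
  map_add' _ _ := rfl
  map_smul' _ _ := rfl
  invFun c := ⟨fun i => c ⟨(i % n).toNat, by
      have h1 := Int.emod_nonneg i (b := n) (by omega)
      have h2 := Int.emod_lt_of_pos i (b := n) (by omega)
      omega⟩, fun i => by simp⟩
  left_inv y := by
    ext i
    have h1 := Int.emod_nonneg i (b := n) (by omega)
    have h2 := affineMaps_apply (mem_periodicMaps.mp y.2) (i / n) (i % n)
    have h3 := Int.emod_add_mul_ediv i n
    rw [show i % n + i / n * n = i by linear_combination h3, mul_zero, add_zero] at h2
    simp only [Int.toNat_of_nonneg h1]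
    exact h2.symm
  right_inv c := by
    ext k
    have : ((k : ℤ) % n).toNat = k := by
      rw [Int.emod_eq_of_lt (by omega) (by omega)]
      simp
    simp [this]

/-- Periodic sequences modulo constants. -/
def directionSpace (n : ℕ) : Submodule ℝ SeqModConst := (periodicMaps n).map constMaps.mkQ

theorem finrank_directionSpace (hn : 0 < n) :
    Module.finrank ℝ (directionSpace n) + 1 = n := by
  have : FiniteDimensional ℝ (periodicMaps n) := (periodicMapsEquiv hn).symm.finiteDimensional
  have hfr : Module.finrank ℝ (periodicMaps n) = n := by
    rw [(periodicMapsEquiv hn).finrank_eq, Module.finrank_fin_fun]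
  let f : periodicMaps n →ₗ[ℝ] SeqModConst := constMaps.mkQ ∘ₗ (periodicMaps n).subtype
  have hrange : LinearMap.range f = directionSpace n := by
    rw [LinearMap.range_comp, Submodule.range_subtype, directionSpace]
  let one : periodicMaps n := ⟨fun _ => 1, fun i => by simp⟩
  have hone : one ≠ 0 := fun h => by
    have := congrFun (congrArg Subtype.val h) 0
    simp [one] at this
  have hker : LinearMap.ker f = Submodule.span ℝ {one} := by
    ext y
    rw [LinearMap.mem_ker, Submodule.mem_span_singleton]
    change constMaps.mkQ y.1 = 0 ↔ _
    rw [Submodule.mkQ_apply, Submodule.Quotient.mk_eq_zero]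
    constructor
    · rintro ⟨a, ha⟩
      refine ⟨a, ?_⟩
      ext i
      simp [one, ha i]
    · rintro ⟨a, rfl⟩
      exact ⟨a, fun i => by simp [one]⟩
  have hrank := f.finrank_range_add_finrank_ker
  rw [hrange, hker, finrank_span_singleton hone, hfr] at hrank
  exact hrank

theorem finiteDimensional_directionSpace (P : AffinePoset n) :
    FiniteDimensional ℝ (directionSpace n) := by
  have : FiniteDimensional ℝ (periodicMaps n) :=
    (periodicMapsEquiv P.pos).symm.finiteDimensional
  unfold directionSpace
  infer_instance

/-! ### Translation orbits of tubes and of tubings -/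

variable (P : AffinePoset n)

/-- Proper tubes up to translation by periods. -/
def tubeSetoid : Setoid {τ // P.IsProperTube τ} where
  r σ τ := ∃ k, τ.1 = shift n k σ.1
  iseqv :=
    { refl := fun σ => ⟨0, (shift_zero _).symm⟩
      symm := fun {σ τ} ⟨k, hk⟩ => ⟨-k, by rw [hk, shift_shift, neg_add_cancel, shift_zero]⟩
      trans := fun {σ τ ρ} ⟨k, hk⟩ ⟨l, hl⟩ => ⟨l + k, by rw [hl, hk, shift_shift]⟩ }

/-- Orbits of proper tubes under translation by periods. -/
abbrev TubeOrbit : Type := Quotient P.tubeSetoid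

instance : Finite P.TubeOrbit := by
  have hfin := P.finite_tubes_meeting.to_subtype
  refine Finite.of_surjective
    (fun τ : {τ | P.IsProperTube τ ∧ ∃ i ∈ τ, 0 ≤ i ∧ i < n} =>
      (Quotient.mk P.tubeSetoid ⟨τ.1, τ.2.1⟩ : P.TubeOrbit)) ?_
  intro o
  induction o using Quotient.inductionOn with
  | _ τ =>
  obtain ⟨k, hk⟩ := τ.2.exists_shift_meets
  exact ⟨⟨_, τ.2.shift k, hk⟩, (Quotient.sound (s := P.tubeSetoid) ⟨k, rfl⟩).symm⟩

variable {P}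

/-- A representative of an orbit of proper tubes. -/
noncomputable def TubeOrbit.rep (o : P.TubeOrbit) : Finset ℤ := (Quotient.out o).1

theorem TubeOrbit.isProperTube_rep (o : P.TubeOrbit) : P.IsProperTube o.rep := (Quotient.out o).2

/-- The orbit of a proper tube. -/
def orbit {τ : Finset ℤ} (h : P.IsProperTube τ) : P.TubeOrbit := Quotient.mk P.tubeSetoid ⟨τ, h⟩

theorem orbit_eq_iff {σ τ : Finset ℤ} (hσ : P.IsProperTube σ) (hτ : P.IsProperTube τ) :
    orbit hσ = orbit hτ ↔ ∃ k, τ = shift n k σ :=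
  ⟨fun h => Quotient.exact h, fun h => Quotient.sound h⟩

theorem orbit_rep (o : P.TubeOrbit) : orbit o.isProperTube_rep = o := Quotient.out_eq o

theorem exists_rep_orbit {τ : Finset ℤ} (h : P.IsProperTube τ) :
    ∃ k, (orbit h).rep = shift n k τ :=
  (orbit_eq_iff h (orbit h).isProperTube_rep).mp (orbit_rep (orbit h)).symm

/-- The tubes whose orbit belongs to `S`. -/
def tubesOf (S : Set P.TubeOrbit) : Set (Finset ℤ) := {τ | ∃ h : P.IsProperTube τ, orbit h ∈ S}

theorem rep_mem_tubesOf {S : Set P.TubeOrbit} {o : P.TubeOrbit} : o.rep ∈ tubesOf S ↔ o ∈ S :=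
  ⟨fun ⟨_, h'⟩ => orbit_rep o ▸ h', fun h => ⟨o.isProperTube_rep, (orbit_rep o).symm ▸ h⟩⟩

theorem tubesOf_subset_tubesOf {S S' : Set P.TubeOrbit} : tubesOf S ⊆ tubesOf S' ↔ S ⊆ S' :=
  ⟨fun h _ ho => rep_mem_tubesOf.mp (h (rep_mem_tubesOf.mpr ho)),
    fun h _ ⟨hτ, ho⟩ => ⟨hτ, h ho⟩⟩

theorem tubesOf_rep {T : Set (Finset ℤ)} (hT : P.IsProperTubing T) :
    tubesOf {o : P.TubeOrbit | o.rep ∈ T} = T := by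
  ext τ
  constructor
  · rintro ⟨hτ, ho⟩
    obtain ⟨k, hk⟩ := exists_rep_orbit hτ
    have ho : (orbit hτ).rep ∈ T := ho
    rw [hk, hT.shift_mem_iff] at ho
    exact ho
  · intro h
    refine ⟨hT.proper τ h, ?_⟩
    obtain ⟨k, hk⟩ := exists_rep_orbit (hT.proper τ h)
    change (orbit (hT.proper τ h)).rep ∈ T
    rw [hk]
    exact hT.shift_mem h k

theorem IsProperTubing.mono {T T' : Set (Finset ℤ)} (hT : P.IsProperTubing T) (h : T' ⊆ T)
    (hper : ∀ τ ∈ T', ∀ k : ℤ, shift n k τ ∈ T') : P.IsProperTubing T' where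
  proper τ hτ := hT.proper τ (h hτ)
  periodic := hper
  nested_or_disjoint σ hσ τ hτ := hT.nested_or_disjoint σ (h hσ) τ (h hτ)
  acyclic τ hτ hcyc := hT.acyclic τ (h hτ)
    (Relation.TransGen.mono (fun _ _ hab => ⟨h hab.1, h hab.2.1, hab.2.2⟩) _ _ hcyc)

theorem shift_mem_tubesOf {S : Set P.TubeOrbit} {τ : Finset ℤ} (h : τ ∈ tubesOf S) (k : ℤ) :
    shift n k τ ∈ tubesOf S := by
  obtain ⟨hτ, ho⟩ := h
  exact ⟨hτ.shift k, (orbit_eq_iff hτ (hτ.shift k)).mpr ⟨k, rfl⟩ ▸ ho⟩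

variable (P)

/-- Sets of orbits forming a proper tubing. -/
def orbitTubings : Set (Set P.TubeOrbit) := {S | P.IsProperTubing (tubesOf S)}

/-- Proper tubings correspond to sets of orbits. -/
def orbitTubingsIso : {S // S ∈ P.orbitTubings} ≃o P.ProperTubing where
  toFun S := ⟨tubesOf S.1, S.2⟩
  invFun T := ⟨{o | o.rep ∈ T.1}, by
    change P.IsProperTubing _
    rw [tubesOf_rep T.2]
    exact T.2⟩
  left_inv S := by
    ext o
    exact rep_mem_tubesOf
  right_inv T := Subtype.ext (tubesOf_rep T.2)
  map_rel_iff' := tubesOf_subset_tubesOf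

/-! ### The half-space system of an affine poset -/

theorem continuous_alphaSeq (τ : Finset ℤ) : Continuous (P.alphaSeq τ) := by
  have : (P.alphaSeq τ : (ℤ → ℝ) → ℝ) = fun x => ∑ e ∈ P.edges τ, (x e.2 - x e.1) :=
    funext fun x => alphaSeq_apply τ x
  rw [this]
  fun_prop

/-- `α_τ` as a continuous functional. -/
noncomputable def alphaL (τ : Finset ℤ) : SeqModConst →L[ℝ] ℝ :=
  ⟨P.alpha τ, (P.continuous_alphaSeq τ).quotient_lift _⟩

/-- The half-spaces of the affine poset cyclohedron, one for each orbit of proper tubes. -/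
noncomputable def halfSpaceSystem : HalfSpaceSystem SeqModConst P.TubeOrbit where
  dir := directionSpace n
  base := constMaps.mkQ (P.nonempty_affineMaps ((n : ℝ) ^ (2 * (n + 1)))).some
  a o := P.alphaL o.rep
  b o := (n : ℝ) ^ (2 * o.rep.card)

variable {P}

theorem alphaSeq_rep_orbit {c : ℝ} {x : ℤ → ℝ} (hx : x ∈ affineMaps n c) {τ : Finset ℤ}
    (h : P.IsProperTube τ) : P.alphaSeq (orbit h).rep x = P.alphaSeq τ x := by
  obtain ⟨k, hk⟩ := exists_rep_orbit h
  rw [hk, alphaSeq_shift_of_affine hx]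

theorem card_rep_orbit {τ : Finset ℤ} (h : P.IsProperTube τ) : (orbit h).rep.card = τ.card := by
  obtain ⟨k, hk⟩ := exists_rep_orbit h
  rw [hk, card_shift]

variable (P)

theorem halfSpaceIntersection_eq : P.halfSpaceIntersection = constMaps.mkQ '' P.feasible := by
  ext p
  constructor
  · rintro ⟨⟨x, hx, rfl⟩, h⟩
    exact ⟨x, ⟨hx, fun τ hτ => (h τ hτ).2⟩, rfl⟩
  · rintro ⟨x, hx, rfl⟩
    exact ⟨⟨x, hx.1, rfl⟩, fun τ hτ => ⟨⟨x, hx.1, rfl⟩, hx.2 τ hτ⟩⟩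

/-- One inequality per orbit suffices, since on affine sequences `α` depends only on the orbit of
the tube. -/
theorem poly_eq : P.halfSpaceSystem.poly = constMaps.mkQ '' P.feasible := by
  have hbase := (P.nonempty_affineMaps ((n : ℝ) ^ (2 * (n + 1)))).some_mem
  set x₀ := (P.nonempty_affineMaps ((n : ℝ) ^ (2 * (n + 1)))).some with hx₀
  ext p
  constructor
  · rintro ⟨⟨y, hy, hyp⟩, h⟩
    have hxp : constMaps.mkQ (x₀ + y) = p := by
      rw [map_add, hyp]
      exact add_sub_cancel _ p
    have hx : x₀ + y ∈ affineMaps n ((n : ℝ) ^ (2 * (n + 1))) := fun i => by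
      rw [Pi.add_apply, Pi.add_apply, hbase i, hy i]
      ring
    refine ⟨x₀ + y, ⟨hx, fun τ hτ => ?_⟩, hxp⟩
    have := h (orbit hτ)
    rw [← hxp] at this
    change _ ≤ P.alphaSeq _ _ at this
    rw [alphaSeq_rep_orbit hx] at this
    change (n : ℝ) ^ (2 * (orbit hτ).rep.card) ≤ _ at this
    rwa [card_rep_orbit] at this
  · rintro ⟨x, hx, rfl⟩
    refine ⟨⟨x - x₀, fun i => ?_, map_sub _ _ _⟩, fun o => hx.2 _ o.isProperTube_rep⟩
    rw [Pi.sub_apply, Pi.sub_apply, hx.1 i, hbase i]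
    ring

variable {P}

theorem tubesOf_tight {x : ℤ → ℝ} (hx : x ∈ P.feasible) :
    tubesOf (P.halfSpaceSystem.tight (constMaps.mkQ x)) = P.tightTubes x := by
  ext τ
  have key : ∀ h : P.IsProperTube τ, orbit h ∈ P.halfSpaceSystem.tight (constMaps.mkQ x) ↔
      P.alphaSeq τ x = (n : ℝ) ^ (2 * τ.card) := by
    intro h
    change P.alphaSeq (orbit h).rep x = (n : ℝ) ^ (2 * (orbit h).rep.card) ↔ _
    rw [alphaSeq_rep_orbit hx.1, card_rep_orbit]
  exact ⟨fun ⟨h, h'⟩ => ⟨h, (key h).mp h'⟩, fun ⟨h, h'⟩ => ⟨h, (key h).mpr h'⟩⟩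

/-- Such a sequence is monotone for the order, and any `i` lies below some translate of any `j`;
periodicity then gives `y i ≤ y j` for all pairs. -/
theorem eq_zero_of_alphaSeq_nonneg {y : ℤ → ℝ} (hy : y ∈ affineMaps n 0)
    (h : ∀ τ, P.IsProperTube τ → 0 ≤ P.alphaSeq τ y) : constMaps.mkQ y = 0 := by
  have hle : ∀ i j, y i ≤ y j := by
    intro i j
    obtain ⟨k, hk⟩ := P.stronglyConnected i j
    have := monotone_of_alphaSeq_nonneg le_rfl hy h hk
    rwa [affineMaps_apply hy, mul_zero, add_zero] at this
  rw [Submodule.mkQ_apply, Submodule.Quotient.mk_eq_zero]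
  exact ⟨y 0, fun i => le_antisymm (hle i 0) (hle 0 i)⟩

theorem exists_periodic_of_orbitTubings {S : Set P.TubeOrbit} (hS : S ∈ P.orbitTubings)
    (c : P.TubeOrbit → ℝ) : ∃ w ∈ directionSpace n, ∀ o ∈ S, P.alphaL o.rep w = c o := by
  have hS : P.IsProperTubing (tubesOf S) := hS
  have htri : ∀ o ∈ S.toFinite.toFinset, ∃ w : periodicMaps n, P.alphaSeq o.rep w.1 ≠ 0 ∧
      ∀ o' ∈ S.toFinite.toFinset, o' ≠ o → o'.rep.card ≤ o.rep.card →
        P.alphaSeq o'.rep w.1 = 0 := by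
    intro o ho
    rw [Set.Finite.mem_toFinset] at ho
    obtain ⟨y, hy, hne, hzero⟩ := hS.exists_periodic (rep_mem_tubesOf.mpr ho)
    refine ⟨⟨y, hy⟩, hne, fun o' ho' hoo' hcard => ?_⟩
    rw [Set.Finite.mem_toFinset] at ho'
    refine hzero _ (rep_mem_tubesOf.mpr ho') hcard fun k hk => hoo' ?_
    rw [← orbit_rep o', ← orbit_rep o]
    exact ((orbit_eq_iff _ _).mpr ⟨k, hk⟩).symm
  obtain ⟨w, hw⟩ := exists_of_triangular
    (fun o : P.TubeOrbit => P.alphaSeq o.rep ∘ₗ (periodicMaps n).subtype)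
    (fun o => o.rep.card) S.toFinite.toFinset htri c
  exact ⟨constMaps.mkQ w.1, ⟨w.1, w.2, rfl⟩, fun o ho => hw o (by simpa using ho)⟩

variable (P)

theorem isSimpleFor : P.halfSpaceSystem.IsSimpleFor P.orbitTubings where
  tight_mem p hp := by
    rw [poly_eq] at hp
    obtain ⟨x, hx, rfl⟩ := hp
    change P.IsProperTubing _
    rw [tubesOf_tight hx]
    exact isProperTubing_tightTubes hx
  exists_point S hS := by
    obtain ⟨x, hx, hsub⟩ := IsProperTubing.exists_feasible hS
    refine ⟨constMaps.mkQ x, ?_, ?_⟩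
    · rw [poly_eq]
      exact ⟨x, hx, rfl⟩
    · rw [← tubesOf_subset_tubesOf, tubesOf_tight hx]
      exact hsub
  independent S hS c := exists_periodic_of_orbitTubings hS c
  empty_mem :=
    { proper := fun τ ⟨_, h⟩ => h.elim
      periodic := fun τ ⟨_, h⟩ => h.elim
      nested_or_disjoint := fun σ ⟨_, h⟩ => h.elim
      acyclic := fun τ ⟨_, h⟩ => h.elim }
  down S hS S' hsub := IsProperTubing.mono hS (tubesOf_subset_tubesOf.mpr hsub)
    fun τ hτ k => shift_mem_tubesOf hτ k
  recession w hw h := by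
    obtain ⟨y, hy, rfl⟩ := hw
    refine eq_zero_of_alphaSeq_nonneg (P := P) hy fun τ hτ => ?_
    rw [← alphaSeq_rep_orbit hy hτ]
    exact h (orbit hτ)

end AffinePoset

theorem theorem2p7 (n : ℕ) (P : AffinePoset n) :
    P.IsCyclohedronRealization P.halfSpaceIntersection := by
  have h := P.isSimpleFor
  have hfd : FiniteDimensional ℝ P.halfSpaceSystem.dir :=
    P.finiteDimensional_directionSpace
  rw [P.halfSpaceIntersection_eq, ← P.poly_eq]
  refine ⟨h.isConvexPolytope, ?_, h.isSimplePolytope,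
    h.faceIso.symm.trans P.orbitTubingsIso.dual, fun F => ?_⟩
  · rw [h.polytopeDim_poly]
    exact AffinePoset.finrank_directionSpace P.pos
  · obtain ⟨T, rfl⟩ := h.faceIso.surjective F
    rw [OrderIso.trans_apply, OrderIso.symm_apply_apply]
    refine (h.face_eq_singleton_iff (OrderDual.ofDual T).2).trans ?_
    change _ ↔ Maximal P.IsProperTubing (AffinePoset.tubesOf (OrderDual.ofDual T).1)
    constructor
    · intro hmax
      refine ⟨(OrderDual.ofDual T).2, fun T' hT' hle => ?_⟩
      have hmem := (P.orbitTubingsIso.symm ⟨T', hT'⟩).2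
      have heq : AffinePoset.tubesOf (P.orbitTubingsIso.symm ⟨T', hT'⟩).1 = T' :=
        AffinePoset.tubesOf_rep hT'
      rw [← heq] at hle ⊢
      exact AffinePoset.tubesOf_subset_tubesOf.mpr
        (hmax.2 hmem (AffinePoset.tubesOf_subset_tubesOf.mp hle))
    · intro hmax
      refine ⟨(OrderDual.ofDual T).2, fun S hS hle => ?_⟩
      exact AffinePoset.tubesOf_subset_tubesOf.mp
        (hmax.2 hS (AffinePoset.tubesOf_subset_tubesOf.mpr hle))
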